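/- **Model.** A *board* is a rectangle $\{1,\dots,m\}\times\{1,\dots,n\}$ of lattice points, each of them open or blocked; its size is $mn$. A *tile* is a lattice point together with a label from a finite alphabet $\Sigma$. Given an affinity function $G:\Sigma\times\Sigma\to\{0,1\}$, two tiles at adjacent points with labels $a,b$ are *bonded* if $G(a,b)=G(b,a)=1$. A *polyomino* is a nonempty finite set of tiles at distinct points whose graph of bonded pairs is connected. A *configuration* is a board together with a finite set of pairwise non-overlapping polyominoes located on open points. A *step* in a direction $d\in\{N,E,S,W\}$ is performed as follows. A polyomino is stuck if its translate by one unit in direction $d$ meets a blocked point or a stuck polyomino (recursively, starting from the blocked points). If all polyominoes are stuck, nothing changes. Otherwise all polyominoes that are not stuck move by one unit in direction $d$, those that then leave the board (have a tile outside it) are removed, and polyominoes containing the two tiles of a bonded pair are merged. A *tilt* in direction $d$ repeats steps in direction $d$ until a step no longer changes the configuration. We write $C\to_* C'$ if $C$ can be turned into $C'$ by a nonempty finite sequence of tilts. An $h\times w$ *pattern* with symbols $0,\dots,k$ is a rectangle of height $h$ and width $w$ each of whose pixels has a symbol in $\{0,\dots,k\}$. Fix an injective assignment of labels to symbols. A configuration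 *strongly represents* a pattern if it consists of a single polyomino whose tiles are, up to a translation, exactly the pixels of the pattern, each with the label assigned to its symbol. A configuration $C$ is *strongly universal* for a set $U$ of patterns if there is a set $\mathcal C$ of configurations such that each $u\in U$ is strongly represented by some member of $\mathcal C$ and $C\to_* C'$ for all $C'\in\mathcal C$. **Statement.** There is an absolute constant $c$ such that for all positive integers $h,w,k$ there are a finite alphabet $\Sigma$, an affinity function on it, an injective assignment of labels in $\Sigma$ to the symbols $0,1,\dots,k$, and a configuration $C$ such that 1. the board of $C$ has size at most $c\,hwk$; 2. $C$ is strongly universal for the set $U$ of all $h\times w$ patterns with symbols in $\{0,1,\dots,k\}$; 3. for every $u\in U$ some sequence of at most $c\,hwk$ tilts turns $C$ into a configuration that strongly represents $u$. -/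

import Mathlib

namespace TiltModel

/-- The four directions of a tilt. -/
inductive Dir
  | N | E | S | W

/-- The unit vector of a direction: the first coordinate grows eastwards, the second northwards. -/
def Dir.vec : Dir → ℤ × ℤ
  | Dir.N => (0, 1)
  | Dir.E => (1, 0)
  | Dir.S => (0, -1)
  | Dir.W => (-1, 0)

/-- Two locations of the square lattice are adjacent if they differ by one unit in exactly one
coordinate. -/
def Adjacent (p q : ℤ × ℤ) : Prop := |p.1 - q.1| + |p.2 - q.2| = 1

/-- The rectangle `{1, …, m} × {1, …, n}` of lattice points. -/
def rect (m n : ℕ) : Set (ℤ × ℤ) := Set.Icc 1 (m : ℤ) ×ˢ Set.Icc 1 (n : ℤ)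

/-- A board: a rectangle of lattice points, some of which are blocked; the others are open. -/
structure Board where
  width : ℕ
  height : ℕ
  blocked : Set (ℤ × ℤ)
  blocked_subset : blocked ⊆ rect width height

/-- All the locations of a board, open or blocked. -/
def Board.region (B : Board) : Set (ℤ × ℤ) := rect B.width B.height

/-- The open locations of a board. -/
def Board.openLocs (B : Board) : Set (ℤ × ℤ) := B.region \ B.blocked

/-- The size of a board: its number of locations, open or blocked. -/
def Board.size (B : Board) : ℕ := B.width * B.height

/-- A tile: a lattice point together with an attachment label. -/
@[ext]
structure Tile (L : Type) where
  pos : ℤ × ℤ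
  label : L

/-- Two tiles are bonded, for the affinity function `G`, if they are adjacent and their labels
attract each other. -/
def Bonded {L : Type} (G : L → L → Bool) (s t : Tile L) : Prop :=
  Adjacent s.pos t.pos ∧ G s.label t.label = true ∧ G t.label s.label = true

/-- A polyomino: a non-empty finite set of tiles at distinct locations whose graph of bonded pairs
is connected.  As bonded tiles are adjacent, its set of locations is then connected as well. -/
structure IsPolyomino {L : Type} (G : L → L → Bool) (P : Set (Tile L)) : Prop where
  nonempty : P.Nonempty
  finite : P.Finite
  injOn : Set.InjOn Tile.pos P
  connected : ∀ s ∈ P, ∀ t ∈ P, Relation.ReflTransGen (fun a b => b ∈ P ∧ Bonded G a b) s t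

/-- The locations that a set of tiles occupies. -/
def locs {L : Type} (P : Set (Tile L)) : Set (ℤ × ℤ) := Tile.pos '' P

/-- A configuration on the board `B`: a finite set of polyominoes, without overlaps among them or
with blocked locations. -/
@[ext]
structure Config {L : Type} (B : Board) (G : L → L → Bool) where
  polys : Set (Set (Tile L))
  finite : polys.Finite
  isPolyomino : ∀ P ∈ polys, IsPolyomino G P
  disjoint : ∀ P ∈ polys, ∀ Q ∈ polys, P ≠ Q → Disjoint (locs P) (locs Q)
  onOpen : ∀ P ∈ polys, locs P ⊆ B.openLocs

/-- Translation of a tile. -/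
def Tile.shift {L : Type} (v : ℤ × ℤ) (t : Tile L) : Tile L := ⟨t.pos + v, t.label⟩

/-- The polyominoes of `M` that cannot move by one unit in direction `d`: those whose translate
meets a blocked location and, recursively, those whose translate meets a polyomino that has already
been found unable to move. -/
inductive Stuck {L : Type} (B : Board) (M : Set (Set (Tile L))) (d : Dir) : Set (Tile L) → Prop
  | wall {P : Set (Tile L)} {t : Tile L} (hP : P ∈ M) (ht : t ∈ P)
      (h : t.pos + d.vec ∈ B.blocked) : Stuck B M d P
  | poly {P Q : Set (Tile L)} {s t : Tile L} (hP : P ∈ M) (hQ : Stuck B M d Q) (hs : s ∈ P)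
      (ht : t ∈ Q) (h : s.pos + d.vec = t.pos) : Stuck B M d P

open Classical in
/-- Where one step in direction `d` puts the polyomino `P`. -/
noncomputable def moveOne {L : Type} (B : Board) (M : Set (Set (Tile L))) (d : Dir)
    (P : Set (Tile L)) : Set (Tile L) :=
  if Stuck B M d P then P else Tile.shift d.vec '' P

/-- The polyominoes after they have moved by one unit, without those that leave the board. -/
def movedPolys {L : Type} (B : Board) (M : Set (Set (Tile L))) (d : Dir) : Set (Set (Tile L)) :=
  {P | P ∈ moveOne B M d '' M ∧ locs P ⊆ B.region}

/-- `P` and `Q` contain the two tiles of a bonded pair. -/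
def Touch {L : Type} (G : L → L → Bool) (P Q : Set (Tile L)) : Prop :=
  ∃ s ∈ P, ∃ t ∈ Q, Bonded G s t

/-- The polyominoes of `M` that are linked to `P` by a chain of bonded pairs of tiles. -/
def cluster {L : Type} (G : L → L → Bool) (M : Set (Set (Tile L))) (P : Set (Tile L)) :
    Set (Set (Tile L)) :=
  {Q | Relation.ReflTransGen (fun A B => A ∈ M ∧ B ∈ M ∧ Touch G A B) P Q}

/-- The result of merging all polyominoes of `M` that contain the two tiles of a bonded pair. -/
def mergePolys {L : Type} (G : L → L → Bool) (M : Set (Set (Tile L))) : Set (Set (Tile L)) :=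
  (fun P => ⋃₀ cluster G M P) '' M

section Facts

variable {L : Type} {G : L → L → Bool} {B : Board}

theorem Bonded.symm {s t : Tile L} (h : Bonded G s t) : Bonded G t s := by
  refine ⟨?_, h.2.2, h.2.1⟩
  have := h.1
  unfold Adjacent at this ⊢
  rw [abs_sub_comm t.pos.1, abs_sub_comm t.pos.2]
  exact this

theorem Bonded.shift {s t : Tile L} (v : ℤ × ℤ) (h : Bonded G s t) :
    Bonded G (s.shift v) (t.shift v) := by
  refine ⟨?_, h.2.1, h.2.2⟩
  have := h.1
  simpa [Adjacent, Tile.shift] using this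

theorem locs_shift (v : ℤ × ℤ) (P : Set (Tile L)) :
    locs (Tile.shift v '' P) = (fun p => p + v) '' locs P := by
  simp only [locs, Set.image_image, Tile.shift]

theorem IsPolyomino.shift {P : Set (Tile L)} (h : IsPolyomino G P) (v : ℤ × ℤ) :
    IsPolyomino G (Tile.shift v '' P) := by
  refine ⟨h.nonempty.image _, h.finite.image _, ?_, ?_⟩
  · rintro _ ⟨s, hs, rfl⟩ _ ⟨t, ht, rfl⟩ hst
    have : s = t := h.injOn hs ht (by simpa [Tile.shift] using hst)
    rw [this]
  · rintro _ ⟨s, hs, rfl⟩ _ ⟨t, ht, rfl⟩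
    refine Relation.ReflTransGen.lift (Tile.shift v) ?_ _ _ (h.connected s hs t ht)
    rintro a b ⟨hb, hab⟩
    exact ⟨⟨b, hb, rfl⟩, hab.shift v⟩

theorem Stuck.mem {M : Set (Set (Tile L))} {d : Dir} {P : Set (Tile L)} (h : Stuck B M d P) :
    P ∈ M := by
  cases h <;> assumption

theorem movedPolys_isPolyomino (C : Config B G) (d : Dir) :
    ∀ P ∈ movedPolys B C.polys d, IsPolyomino G P := by
  rintro _ ⟨⟨P, hP, rfl⟩, -⟩
  unfold moveOne
  split_ifs
  · exact C.isPolyomino P hP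
  · exact (C.isPolyomino P hP).shift _

theorem movedPolys_disjoint (C : Config B G) (d : Dir) :
    ∀ P ∈ movedPolys B C.polys d, ∀ Q ∈ movedPolys B C.polys d, P ≠ Q →
      Disjoint (locs P) (locs Q) := by
  have key : ∀ P ∈ C.polys, ∀ Q, Stuck B C.polys d Q → ¬ Stuck B C.polys d P →
      Disjoint (locs (Tile.shift d.vec '' P)) (locs Q) := by
    intro P hP Q hQ hPs
    rw [Set.disjoint_left]
    rintro _ ⟨_, ⟨s, hs, rfl⟩, rfl⟩ ⟨t, ht, hst⟩
    exact hPs (Stuck.poly hP hQ hs ht hst.symm)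
  rintro _ ⟨⟨P, hP, rfl⟩, -⟩ _ ⟨⟨Q, hQ, rfl⟩, -⟩ hne
  have hPQ : P ≠ Q := fun h => hne (by rw [h])
  have hd := C.disjoint P hP Q hQ hPQ
  unfold moveOne
  split_ifs with h1 h2 h2
  · exact hd
  · exact (key Q hQ P h1 h2).symm
  · exact key P hP Q h2 h1
  · rw [locs_shift, locs_shift]
    exact (Set.disjoint_image_iff (add_left_injective d.vec)).2 hd

theorem movedPolys_onOpen (C : Config B G) (d : Dir) :
    ∀ P ∈ movedPolys B C.polys d, locs P ⊆ B.openLocs := by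
  rintro _ ⟨⟨P, hP, rfl⟩, hr⟩
  unfold moveOne at hr ⊢
  split_ifs at hr ⊢ with h
  · exact C.onOpen P hP
  · intro p hp
    refine ⟨hr hp, fun hb => h ?_⟩
    obtain ⟨_, ⟨t, ht, rfl⟩, rfl⟩ := hp
    exact Stuck.wall hP ht hb

theorem cluster_subset {M : Set (Set (Tile L))} {P Q : Set (Tile L)} (hP : P ∈ M)
    (h : Q ∈ cluster G M P) : Q ∈ M := by
  rcases Relation.ReflTransGen.cases_tail h with h | ⟨_, _, h⟩
  · rwa [h]
  · exact h.2.1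

theorem cluster_symm {M : Set (Set (Tile L))} {P Q : Set (Tile L)}
    (h : Q ∈ cluster G M P) : P ∈ cluster G M Q := by
  unfold cluster at h ⊢
  induction h with
  | refl => exact Relation.ReflTransGen.refl
  | tail _ hAB ih =>
    obtain ⟨hA, hB, s, hs, t, ht, hst⟩ := hAB
    exact Relation.ReflTransGen.head ⟨hB, hA, t, ht, s, hs, hst.symm⟩ ih

theorem cluster_eq {M : Set (Set (Tile L))} {P Q : Set (Tile L)}
    (h : Q ∈ cluster G M P) : cluster G M P = cluster G M Q := by
  ext R
  exact ⟨fun hR => Relation.ReflTransGen.trans (cluster_symm h) hR,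
    fun hR => Relation.ReflTransGen.trans h hR⟩

theorem eq_of_locs {M : Set (Set (Tile L))}
    (hd : ∀ P ∈ M, ∀ Q ∈ M, P ≠ Q → Disjoint (locs P) (locs Q)) {P Q : Set (Tile L)}
    (hP : P ∈ M) (hQ : Q ∈ M) {s t : Tile L} (hs : s ∈ P) (ht : t ∈ Q) (h : s.pos = t.pos) :
    P = Q := by
  by_contra hne
  exact Set.disjoint_left.1 (hd P hP Q hQ hne) ⟨s, hs, rfl⟩ ⟨t, ht, h.symm⟩

theorem cluster_isPolyomino {M : Set (Set (Tile L))} (hf : M.Finite)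
    (hp : ∀ P ∈ M, IsPolyomino G P)
    (hd : ∀ P ∈ M, ∀ Q ∈ M, P ≠ Q → Disjoint (locs P) (locs Q)) {P : Set (Tile L)}
    (hP : P ∈ M) : IsPolyomino G (⋃₀ cluster G M P) := by
  have hsub : ∀ Q ∈ cluster G M P, Q ∈ M := fun Q hQ => cluster_subset hP hQ
  have inside : ∀ Q ∈ cluster G M P, ∀ s ∈ Q, ∀ t ∈ Q,
      Relation.ReflTransGen (fun a b => b ∈ ⋃₀ cluster G M P ∧ Bonded G a b) s t := by
    intro Q hQ s hs t ht
    exact Relation.ReflTransGen.mono (fun a b hab => ⟨⟨Q, hQ, hab.1⟩, hab.2⟩) _ _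
      ((hp Q (hsub Q hQ)).connected s hs t ht)
  have fromP : ∀ Q ∈ cluster G M P, ∀ s ∈ P, ∀ t ∈ Q,
      Relation.ReflTransGen (fun a b => b ∈ ⋃₀ cluster G M P ∧ Bonded G a b) s t := by
    intro Q hQ
    induction hQ with
    | refl => exact fun s hs t ht => inside P Relation.ReflTransGen.refl s hs t ht
    | @tail A D hA hAD ih =>
      intro s hs t ht
      have hD : D ∈ cluster G M P := Relation.ReflTransGen.tail hA hAD
      obtain ⟨-, -, a, ha, b, hb, hab⟩ := hAD
      exact ((ih s hs a ha).tail ⟨⟨D, hD, hb⟩, hab⟩).trans (inside D hD b hb t ht)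
  refine ⟨?_, ?_, ?_, ?_⟩
  · obtain ⟨s, hs⟩ := (hp P hP).nonempty
    exact ⟨s, P, Relation.ReflTransGen.refl, hs⟩
  · exact Set.Finite.sUnion (hf.subset hsub) fun Q hQ => (hp Q (hsub Q hQ)).finite
  · rintro s ⟨Q, hQ, hs⟩ t ⟨R, hR, ht⟩ hst
    have hQR := eq_of_locs hd (hsub Q hQ) (hsub R hR) hs ht hst
    subst hQR
    exact (hp Q (hsub Q hQ)).injOn hs ht hst
  · rintro s ⟨Q, hQ, hs⟩ t ⟨R, hR, ht⟩
    have h := cluster_eq hQ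
    have hP' : P ∈ cluster G M P := Relation.ReflTransGen.refl
    obtain ⟨p, hpP⟩ := (hp P hP).nonempty
    refine Relation.ReflTransGen.trans ?_ (fromP R hR p hpP t ht)
    have hback := fromP Q hQ p hpP s hs
    clear ht hR
    have : ∀ a, Relation.ReflTransGen
        (fun a b => b ∈ ⋃₀ cluster G M P ∧ Bonded G a b) p a →
        Relation.ReflTransGen (fun a b => b ∈ ⋃₀ cluster G M P ∧ Bonded G a b) a p ∧
          a ∈ ⋃₀ cluster G M P := by
      intro a ha
      induction ha with
      | refl => exact ⟨Relation.ReflTransGen.refl, P, hP', hpP⟩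
      | @tail b c _ hbc ih =>
        exact ⟨Relation.ReflTransGen.head ⟨ih.2, hbc.2.symm⟩ ih.1, hbc.1⟩
    exact (this s hback).1

theorem mergePolys_disjoint {M : Set (Set (Tile L))}
    (hd : ∀ P ∈ M, ∀ Q ∈ M, P ≠ Q → Disjoint (locs P) (locs Q)) :
    ∀ P ∈ mergePolys G M, ∀ Q ∈ mergePolys G M, P ≠ Q → Disjoint (locs P) (locs Q) := by
  rintro _ ⟨P, hP, rfl⟩ _ ⟨Q, hQ, rfl⟩ hne
  rw [Set.disjoint_left]
  rintro _ ⟨s, ⟨P', hP', hs⟩, rfl⟩ ⟨t, ⟨Q', hQ', ht⟩, hst⟩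
  have h := eq_of_locs hd (cluster_subset hP hP') (cluster_subset hQ hQ') hs ht hst.symm
  subst h
  exact hne (by simp only [cluster_eq hP', cluster_eq hQ'])

end Facts

open Classical in
/-- One step in direction `d`: nothing changes if no polyomino can move; otherwise all polyominoes
that are not stuck move by one unit, those that leave the board are removed, and bonded
polyominoes merge. -/
noncomputable def Config.step {L : Type} {G : L → L → Bool} {B : Board} (d : Dir)
    (C : Config B G) : Config B G :=
  if ∀ P ∈ C.polys, Stuck B C.polys d P then C else
  { polys := mergePolys G (movedPolys B C.polys d)
    finite := ((C.finite.image _).subset fun _ h => h.1).image _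
    isPolyomino := by
      rintro _ ⟨P, hP, rfl⟩
      exact cluster_isPolyomino ((C.finite.image _).subset fun _ h => h.1)
        (movedPolys_isPolyomino C d) (movedPolys_disjoint C d) hP
    disjoint := mergePolys_disjoint (movedPolys_disjoint C d)
    onOpen := by
      rintro _ ⟨P, hP, rfl⟩ _ ⟨s, ⟨Q, hQ, hs⟩, rfl⟩
      exact movedPolys_onOpen C d Q (cluster_subset hP hQ) ⟨s, hs, rfl⟩ }

/-- A tilt in direction `d` turns `C` into `C'`: repeated steps in direction `d` lead from `C` to
`C'`, which a further step does not change. -/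
def Tilt {L : Type} {G : L → L → Bool} {B : Board} (d : Dir) (C C' : Config B G) : Prop :=
  (∃ n : ℕ, (Config.step d)^[n] C = C') ∧ C'.step d = C'

/-- `C` can be reconfigured into `C'` by one tilt in some direction. -/
def ReconfiguresInOne {L : Type} {G : L → L → Bool} {B : Board} (C C' : Config B G) : Prop :=
  ∃ d, Tilt d C C'

/-- `C` can be reconfigured into `C'`: the transitive closure of `ReconfiguresInOne`. -/
def Reconfigures {L : Type} {G : L → L → Bool} {B : Board} : Config B G → Config B G → Prop :=
  Relation.TransGen ReconfiguresInOne

/-- The tilt sequence `ds`, performed from left to right, turns `C` into `C'`. -/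
def TiltSeq {L : Type} {G : L → L → Bool} {B : Board} :
    List Dir → Config B G → Config B G → Prop
  | [], C, C' => C = C'
  | d :: ds, C, C' => ∃ C₁, Tilt d C C₁ ∧ TiltSeq ds C₁ C'

/-- `C` is a universal configuration for the set `𝒞` of configurations. -/
def UniversalConfig {L : Type} {G : L → L → Bool} {B : Board} (C : Config B G)
    (𝒞 : Set (Config B G)) : Prop :=
  ∀ C' ∈ 𝒞, Reconfigures C C'

/-- A pattern over the set `S` of symbols: a set of pixels, each with a symbol. -/
structure Pattern (S : Type) where
  pixels : Set (ℤ × ℤ)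
  symbol : pixels → S

/-- The patterns of height `h` and width `w`: rectangles each of whose pixels has a symbol
from `S`. -/
def rectPatterns (h w : ℕ) (S : Type) : Set (Pattern S) := {u | u.pixels = rect w h}

/-- `C` strongly represents the pattern `u`, if the symbol `x` is represented by the attachment
label `enc x`: it consists of a single polyomino, whose tiles are, up to a translation, exactly the
pixels of `u`, each with the label of its symbol. -/
def StronglyRepresents {L S : Type} {G : L → L → Bool} {B : Board} (enc : S ↪ L)
    (C : Config B G) (u : Pattern S) : Prop :=
  ∃ v : ℤ × ℤ, C.polys = {Set.range fun p : u.pixels => (⟨p.1 + v, enc (u.symbol p)⟩ : Tile L)}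

/-- `C` is strongly universal for the set `U` of patterns. -/
def StronglyUniversal {L S : Type} {G : L → L → Bool} {B : Board} (enc : S ↪ L)
    (C : Config B G) (U : Set (Pattern S)) : Prop :=
  ∃ 𝒞 : Set (Config B G),
    (∀ u ∈ U, ∃ C' ∈ 𝒞, StronglyRepresents enc C' u) ∧ UniversalConfig C 𝒞

end TiltModel

/-! The construction is a machine whose moving parts all obey the same global tilts. Every label
attracts every label, the alphabet is just the set of symbols, and tile `n` carries the symbol `n`
modulo `k + 1`. Thus `h * w` blocks of `k + 1` tiles wait in a queue, one block per pixel and one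
tile per symbol within a block. For each pixel exactly one tile of its block is kept, the others are
discarded. When the queue is exhausted, only the assembled rectangle remains on the board.

The queue is a winding track of `h` bands with `M = w * (k + 1)` slots each. The cycle E, N, E, S,
W, S advances each tile by one slot: eastwards within a band, and from the eastern end through a
corridor back to the western end of the band below. In such a cycle the front tile is carried under
the column that is being built, which falls on it and so grows at its lower end. An additional S
after the first E makes the front tile leave through a lift at the bottom of the board instead,
while nothing else moves. A full column fills the height of its well. The sequence W, S, E, W then
drops it into a pit, pushes the rectangle of earlier columns against it, and brings the track back
to its state of rest. A cycle thus costs six or seven tilts per tile and a transfer four tilts per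
column, and the board has area of order `M * h`.

As any contact glues, the point to verify is that pieces meet only when they should. If pieces stay
at king distance at least two, each moves as if it were alone, so a tilt is given by one
displacement per piece (`tilt_slide`). `tilt_exit` and `tilt_unite` treat one departure and one
intended contact. The motion of the queue under each tilt is a family of inequalities in coordinates
(`SlotRun`), and `fam_far` combines it with the column and the rectangle. `keep_cycle`,
`discard_cycle` and `transfer_column` are then iterated over symbols, rows and columns. -/

namespace TiltModel

/-! ### Tilts of configurations with separated pieces -/

section Dynamics

variable {L : Type} {G : L → L → Bool} {B : Board} {ι : Type}

/-- The polyominoes of a family of sets of tiles, in which an empty set stands for nothing. -/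
def pieces (F : ι → Set (Tile L)) : Set (Set (Tile L)) := {P | P.Nonempty ∧ ∃ i, F i = P}

/-- Two locations at king distance at least two. -/
def Far (p q : ℤ × ℤ) : Prop :=
  p.1 + 2 ≤ q.1 ∨ q.1 + 2 ≤ p.1 ∨ p.2 + 2 ≤ q.2 ∨ q.2 + 2 ≤ p.2

theorem Far.symm {p q : ℤ × ℤ} (h : Far p q) : Far q p := by
  unfold Far at *; omega

theorem Far.not_adjacent {p q : ℤ × ℤ} (h : Far p q) : ¬ Adjacent p q := by
  unfold Far Adjacent at *
  intro h'
  have h1 := abs_le.1 (show |p.1 - q.1| ≤ 1 by linarith [abs_nonneg (p.2 - q.2)])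
  have h2 := abs_le.1 (show |p.2 - q.2| ≤ 1 by linarith [abs_nonneg (p.1 - q.1)])
  omega

theorem Far.ne {p q : ℤ × ℤ} (h : Far p q) : p ≠ q := by
  rintro rfl
  unfold Far at h
  omega

theorem Far.ne_add_vec {p q : ℤ × ℤ} (h : Far p q) (d : Dir) : p + d.vec ≠ q := by
  rintro rfl
  unfold Far at h
  cases d <;> simp [Dir.vec] at h <;> omega

/-- The sets of tiles of a family are pairwise far from each other. -/
def Apart (F : ι → Set (Tile L)) : Prop :=
  ∀ i j, i ≠ j → ∀ s ∈ F i, ∀ t ∈ F j, Far s.pos t.pos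

/-- Separated pieces cannot obstruct each other within one step, so the recursion in `Stuck` never
passes from one piece to another and ends at a wall of the piece itself. -/
theorem stuck_pieces_iff {F : ι → Set (Tile L)} (hF : Apart F) {d : Dir} {i : ι}
    (hi : (F i).Nonempty) :
    Stuck B (pieces F) d (F i) ↔ ∃ t ∈ F i, t.pos + d.vec ∈ B.blocked := by
  constructor
  · intro h
    generalize F i = P at h
    clear hi
    induction h with
    | wall _ ht h => exact ⟨_, ht, h⟩
    | @poly P Q s t hP hQ hs ht h ih =>
      obtain ⟨_, i, rfl⟩ := hP
      obtain ⟨_, j, rfl⟩ := hQ.mem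
      by_cases hij : i = j
      · subst hij; exact ih
      · exact absurd h ((hF i j hij s hs t ht).ne_add_vec d)
  · rintro ⟨t, ht, h⟩
    exact Stuck.wall ⟨hi, i, rfl⟩ ht h

/-- What one unit of motion in direction `d` does to a piece that touches no other piece. -/
def Moves (B : Board) (d : Dir) (P P' : Set (Tile L)) : Prop :=
  ((∃ t ∈ P, t.pos + d.vec ∈ B.blocked) ∧ P' = P) ∨
  ((∀ t ∈ P, t.pos + d.vec ∉ B.blocked) ∧
    ((P' = Tile.shift d.vec '' P ∧ ∀ t ∈ P, t.pos + d.vec ∈ B.region) ∨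
      (P' = ∅ ∧ ∃ t ∈ P, t.pos + d.vec ∉ B.region)))

/-- Only separation before the step is assumed. Afterwards pieces may be in contact, which is what
makes the lemma usable for a step that ends in a merger. -/
theorem movedPolys_pieces {C : Config B G} {F F' : ι → Set (Tile L)} {d : Dir}
    (hC : C.polys = pieces F) (hF : Apart F) (h : ∀ i, Moves B d (F i) (F' i)) :
    movedPolys B C.polys d = pieces F' := by
  classical
  have key : ∀ i, (F i).Nonempty →
      (moveOne B C.polys d (F i) = F' i ∧ locs (F' i) ⊆ B.region) ∨
      (¬ locs (moveOne B C.polys d (F i)) ⊆ B.region ∧ F' i = ∅) := by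
    intro i hi
    unfold moveOne
    rw [hC]
    rcases h i with ⟨h1, h2⟩ | ⟨h1, h2⟩
    · rw [if_pos ((stuck_pieces_iff hF hi).2 h1), h2]
      refine Or.inl ⟨rfl, ?_⟩
      exact (C.onOpen (F i) (by rw [hC]; exact ⟨hi, i, rfl⟩)).trans Set.sdiff_subset
    · have hns : ¬ Stuck B (pieces F) d (F i) := by
        rw [stuck_pieces_iff hF hi]
        push Not
        exact h1
      rw [if_neg hns]
      rcases h2 with ⟨h2, h3⟩ | ⟨h2, t, ht, h3⟩
      · refine Or.inl ⟨h2.symm, ?_⟩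
        rw [h2]
        rintro _ ⟨_, ⟨t, ht, rfl⟩, rfl⟩
        exact h3 t ht
      · exact Or.inr ⟨fun hsub => h3 (hsub ⟨_, ⟨t, ht, rfl⟩, rfl⟩), h2⟩
  have hne : ∀ i, (F' i).Nonempty → (F i).Nonempty := by
    rintro i ⟨t, ht⟩
    rcases h i with ⟨h1, h2⟩ | ⟨h1, ⟨h2, h3⟩ | ⟨h2, h3⟩⟩
    · rw [← h2]; exact ⟨t, ht⟩
    · rw [h2] at ht
      exact Set.Nonempty.of_image ⟨t, ht⟩
    · rw [h2] at ht; exact ht.elim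
  ext P
  constructor
  · rintro ⟨⟨Q, hQ, rfl⟩, hreg⟩
    have hQ' := hQ
    rw [hC] at hQ'
    obtain ⟨hi, i, rfl⟩ := hQ'
    rcases key i hi with ⟨h1, h2⟩ | ⟨h1, h2⟩
    · refine ⟨?_, i, h1.symm⟩
      unfold moveOne
      split_ifs
      · exact hi
      · exact hi.image _
    · exact absurd hreg h1
  · rintro ⟨hP, i, rfl⟩
    have hi := hne i hP
    rcases key i hi with ⟨h1, h2⟩ | ⟨h1, h2⟩
    · exact ⟨⟨F i, by rw [hC]; exact ⟨hi, i, rfl⟩, h1⟩, h2⟩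
    · rw [h2] at hP
      exact absurd hP Set.not_nonempty_empty

theorem mergePolys_eq_self {M : Set (Set (Tile L))}
    (h : ∀ P ∈ M, ∀ Q ∈ M, Touch G P Q → P = Q) : mergePolys G M = M := by
  have key : ∀ P ∈ M, ⋃₀ cluster G M P = P := by
    intro P hP
    have : cluster G M P = {P} := by
      ext Q
      constructor
      · intro hQ
        induction hQ with
        | refl => rfl
        | tail _ hAB ih => exact (h _ hAB.1 _ hAB.2.1 hAB.2.2).symm.trans ih
      · rintro rfl
        exact Relation.ReflTransGen.refl
    rw [this, Set.sUnion_singleton]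
  ext P
  constructor
  · rintro ⟨Q, hQ, rfl⟩
    simpa only [key Q hQ] using hQ
  · exact fun hP => ⟨P, hP, key P hP⟩

theorem Apart.mergePolys {F : ι → Set (Tile L)} (hF : Apart F) :
    mergePolys G (pieces F) = pieces F := by
  refine mergePolys_eq_self ?_
  rintro _ ⟨_, i, rfl⟩ _ ⟨_, j, rfl⟩ ⟨s, hs, t, ht, hst⟩
  by_contra hne
  exact (hF i j (fun h => hne (by rw [h])) s hs t ht).not_adjacent hst.1

theorem step_polys_of_moving {C : Config B G} {d : Dir}
    (h : ∃ P ∈ C.polys, ¬ Stuck B C.polys d P) :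
    (C.step d).polys = mergePolys G (movedPolys B C.polys d) := by
  unfold Config.step
  rw [if_neg (by push Not; exact h)]

theorem step_polys_of_stuck {C : Config B G} {d : Dir}
    (h : ∀ P ∈ C.polys, Stuck B C.polys d P) : C.step d = C := by
  unfold Config.step
  rw [if_pos h]

theorem step_pieces {C : Config B G} {F F' : ι → Set (Tile L)} {d : Dir}
    (hC : C.polys = pieces F) (hF : Apart F) (hF' : Apart F')
    (h : ∀ i, Moves B d (F i) (F' i)) : (C.step d).polys = pieces F' := by
  have hm := movedPolys_pieces hC hF h
  -- A step in which everything is stuck performs no merging and has to be treated apart. Then the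
  -- moved family is the old one.
  by_cases hs : ∀ P ∈ C.polys, Stuck B C.polys d P
  · rw [step_polys_of_stuck hs, ← hm]
    ext P
    constructor
    · intro hP
      refine ⟨⟨P, hP, ?_⟩, (C.onOpen P hP).trans Set.sdiff_subset⟩
      unfold moveOne
      rw [if_pos (hs P hP)]
    · rintro ⟨⟨Q, hQ, rfl⟩, -⟩
      unfold moveOne
      rw [if_pos (hs Q hQ)]
      exact hQ
  · push Not at hs
    rw [step_polys_of_moving hs, hm, hF'.mergePolys]

open Classical in
/-- The family in which the pieces `p` and `q` have been united. -/
noncomputable def unite (F : ι → Set (Tile L)) (p q : ι) (i : ι) : Set (Tile L) :=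
  if i = p then F p ∪ F q else if i = q then ∅ else F i

/-- With `p` and `q` the only pieces that may be close, a chain of bonded pairs never leaves the set
of these two, so the clusters are this pair and singletons. -/
theorem mergePolys_unite {F : ι → Set (Tile L)} {p q : ι} (hpq : p ≠ q)
    (hF : ∀ i j, i ≠ j → ¬ (i = p ∧ j = q) → ¬ (i = q ∧ j = p) →
      ∀ s ∈ F i, ∀ t ∈ F j, Far s.pos t.pos)
    (ht : Touch G (F p) (F q)) : mergePolys G (pieces F) = pieces (unite F p q) := by
  have hp : F p ∈ pieces F := ⟨by obtain ⟨s, hs, -⟩ := ht; exact ⟨s, hs⟩, p, rfl⟩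
  have hq : F q ∈ pieces F := ⟨by obtain ⟨_, _, s, hs, -⟩ := ht; exact ⟨s, hs⟩, q, rfl⟩
  have ht' : Touch G (F q) (F p) := by
    obtain ⟨s, hs, t, ht, hst⟩ := ht
    exact ⟨t, ht, s, hs, hst.symm⟩
  have touch : ∀ i j, Touch G (F i) (F j) → i = j ∨ (i = p ∧ j = q) ∨ (i = q ∧ j = p) := by
    rintro i j ⟨s, hs, t, ht, hst⟩
    by_contra! hne
    exact (hF i j hne.1 (fun h => hne.2.1 h.1 h.2) (fun h => hne.2.2 h.1 h.2) s hs t ht).not_adjacent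
      hst.1
  have cp : ⋃₀ cluster G (pieces F) (F p) = F p ∪ F q := by
    have : cluster G (pieces F) (F p) = {F p, F q} := by
      ext Q
      constructor
      · intro hQ
        induction hQ with
        | refl => exact Or.inl rfl
        | @tail A D _ hAB ih =>
          obtain ⟨hA, ⟨_, j, rfl⟩, hT⟩ := hAB
          rcases ih with rfl | rfl
          · rcases touch _ _ hT with rfl | ⟨-, rfl⟩ | ⟨h, rfl⟩
            · exact Or.inl rfl
            · exact Or.inr rfl
            · exact Or.inl rfl
          · rcases touch _ _ hT with rfl | ⟨-, rfl⟩ | ⟨h, rfl⟩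
            · exact Or.inr rfl
            · exact Or.inr rfl
            · exact Or.inl rfl
      · rintro (rfl | rfl)
        · exact Relation.ReflTransGen.refl
        · exact Relation.ReflTransGen.single ⟨hp, hq, ht⟩
    rw [this, Set.sUnion_pair]
  have cq : ⋃₀ cluster G (pieces F) (F q) = F p ∪ F q := by
    rw [← cp, cluster_eq (P := F p) (Q := F q) (Relation.ReflTransGen.single ⟨hp, hq, ht⟩)]
  have ci : ∀ i, i ≠ p → i ≠ q → (F i).Nonempty → ⋃₀ cluster G (pieces F) (F i) = F i := by
    intro i hip hiq hi
    have : cluster G (pieces F) (F i) = {F i} := by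
      ext Q
      constructor
      · intro hQ
        induction hQ with
        | refl => rfl
        | @tail A D _ hAB ih =>
          obtain ⟨hA, ⟨_, j, rfl⟩, hT⟩ := hAB
          rw [Set.mem_singleton_iff] at ih
          subst ih
          rcases touch _ _ hT with rfl | ⟨h, -⟩ | ⟨h, -⟩
          · rfl
          · exact absurd h hip
          · exact absurd h hiq
      · rintro rfl
        exact Relation.ReflTransGen.refl
    rw [this, Set.sUnion_singleton]
  ext P
  constructor
  · rintro ⟨Q, ⟨hi, i, rfl⟩, rfl⟩
    dsimp only
    by_cases hip : i = p
    · subst hip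
      rw [cp]
      exact ⟨hi.inl, i, by simp [unite]⟩
    · by_cases hiq : i = q
      · subst hiq
        rw [cq]
        exact ⟨hi.inr, p, by simp [unite]⟩
      · rw [ci i hip hiq hi]
        exact ⟨hi, i, by simp [unite, hip, hiq]⟩
  · rintro ⟨hP, i, rfl⟩
    unfold unite at hP ⊢
    split_ifs at hP ⊢ with h1 h2
    · exact ⟨F p, hp, cp⟩
    · exact absurd hP Set.not_nonempty_empty
    · exact ⟨F i, ⟨hP, i, rfl⟩, ci i h1 h2 hP⟩

/-- The piece `r` witnesses that something moves. Otherwise the step would be void and nothing would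
merge. -/
theorem step_unite {C : Config B G} {F F' : ι → Set (Tile L)} {d : Dir} {p q r : ι}
    (hC : C.polys = pieces F) (hF : Apart F) (hpq : p ≠ q)
    (hF' : ∀ i j, i ≠ j → ¬ (i = p ∧ j = q) → ¬ (i = q ∧ j = p) →
      ∀ s ∈ F' i, ∀ t ∈ F' j, Far s.pos t.pos)
    (ht : Touch G (F' p) (F' q)) (h : ∀ i, Moves B d (F i) (F' i))
    (hr : (F r).Nonempty) (hr' : ∀ t ∈ F r, t.pos + d.vec ∉ B.blocked) :
    (C.step d).polys = pieces (unite F' p q) := by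
  have hm := movedPolys_pieces hC hF h
  rw [step_polys_of_moving, hm, mergePolys_unite hpq hF' ht]
  refine ⟨F r, by rw [hC]; exact ⟨hr, r, rfl⟩, ?_⟩
  rw [hC, stuck_pieces_iff hF hr]
  push Not
  exact hr'

/-- The family in which each piece `i` has moved by `m i` units in direction `d`, but by at most
`n` units. -/
def slid (d : Dir) (m : ι → ℕ) (F : ι → Set (Tile L)) (n : ℕ) (i : ι) : Set (Tile L) :=
  Tile.shift ((min n (m i)) • d.vec) '' F i

theorem shift_zero (t : Tile L) : t.shift 0 = t := by
  simp [Tile.shift]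

theorem shift_shift (t : Tile L) (u v : ℤ × ℤ) : (t.shift u).shift v = t.shift (u + v) := by
  simp [Tile.shift, add_assoc]

theorem slid_zero (d : Dir) (m : ι → ℕ) (F : ι → Set (Tile L)) : slid d m F 0 = F := by
  funext i
  simp [slid, shift_zero]

/-- The pieces of `F` can make `m i` moves in direction `d` without hitting the boundary, and
those with `m i < T` are then stopped by a blocked location. -/
structure Runs (B : Board) (d : Dir) (m : ι → ℕ) (F : ι → Set (Tile L)) (T : ℕ) : Prop where
  path : ∀ i, ∀ t ∈ F i, ∀ n, 0 < n → n ≤ m i → t.pos + n • d.vec ∈ B.openLocs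
  halt : ∀ i, m i < T → (F i).Nonempty → ∃ t ∈ F i, t.pos + (m i + 1) • d.vec ∈ B.blocked

theorem Runs.moves {d : Dir} {m : ι → ℕ} {F : ι → Set (Tile L)} {T : ℕ} (h : Runs B d m F T)
    {n : ℕ} (hn : n < T) (i : ι) : Moves B d (slid d m F n i) (slid d m F (n + 1) i) := by
  by_cases hi : n < m i
  · right
    have h1 : min n (m i) = n := by omega
    have h2 : min (n + 1) (m i) = n + 1 := by omega
    have hs : ∀ t ∈ slid d m F n i, t.pos + d.vec ∈ B.openLocs := by
      rintro _ ⟨t, ht, rfl⟩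
      have := h.path i t ht (n + 1) (by omega) (by omega)
      simp only [Tile.shift, h1]
      rwa [add_assoc, ← succ_nsmul]
    refine ⟨fun t ht => (hs t ht).2, Or.inl ⟨?_, fun t ht => (hs t ht).1⟩⟩
    simp only [slid, h1, h2, Set.image_image, shift_shift, succ_nsmul]
  · have h1 : min n (m i) = m i := by omega
    have h2 : min (n + 1) (m i) = m i := by omega
    rcases (F i).eq_empty_or_nonempty with he | hne
    · right
      simp [slid, he]
    · left
      obtain ⟨t, ht, hb⟩ := h.halt i (by omega) hne
      refine ⟨⟨_, ⟨t, ht, rfl⟩, ?_⟩, by simp only [slid, h1, h2]⟩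
      simp only [Tile.shift, h1]
      rwa [add_assoc, ← succ_nsmul]

/-- Separation is needed at every intermediate time, since pieces with different displacements stop
at different times. -/
theorem iterate_slid {C : Config B G} {F : ι → Set (Tile L)} {d : Dir} {m : ι → ℕ} {T : ℕ}
    (hC : C.polys = pieces F) (hr : Runs B d m F T) (hF : ∀ n ≤ T, Apart (slid d m F n)) :
    ∀ n ≤ T, ((Config.step d)^[n] C).polys = pieces (slid d m F n) := by
  intro n
  induction n with
  | zero => intro _; simpa [slid_zero] using hC
  | succ n ih =>
    intro hn
    rw [Function.iterate_succ_apply']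
    exact step_pieces (ih (by omega)) (hF n (by omega)) (hF _ hn) (hr.moves (by omega))

theorem step_eq_self {C : Config B G} {F : ι → Set (Tile L)} {d : Dir}
    (hC : C.polys = pieces F)
    (h : ∀ i, (F i).Nonempty → ∃ t ∈ F i, t.pos + d.vec ∈ B.blocked) : C.step d = C := by
  refine step_polys_of_stuck ?_
  intro P hP
  have hP' := hP
  rw [hC] at hP'
  obtain ⟨hi, i, rfl⟩ := hP'
  obtain ⟨t, ht, hb⟩ := h i hi
  exact Stuck.wall hP ht hb

/-- A tilt in which no two pieces meet. -/
theorem tilt_slide {C : Config B G} {F : ι → Set (Tile L)} {d : Dir} {m : ι → ℕ} {T : ℕ}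
    (hC : C.polys = pieces F) (hT : ∀ i, m i ≤ T) (hr : Runs B d m F (T + 1))
    (hF : ∀ n ≤ T, Apart (slid d m F n)) :
    ∃ C' : Config B G, Tilt d C C' ∧
      C'.polys = pieces fun i => Tile.shift (m i • d.vec) '' F i := by
  have hC' := iterate_slid hC ⟨hr.path, fun i hi => hr.halt i (by omega)⟩ hF T le_rfl
  have he : slid d m F T = fun i => Tile.shift (m i • d.vec) '' F i := by
    funext i
    simp only [slid, min_eq_right (hT i)]
  rw [he] at hC'
  refine ⟨_, ⟨⟨T, rfl⟩, step_eq_self hC' ?_⟩, hC'⟩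
  intro i hi
  obtain ⟨t, ht, hb⟩ := hr.halt i (by have := hT i; omega) (Set.image_nonempty.1 hi)
  refine ⟨_, ⟨t, ht, rfl⟩, ?_⟩
  simp only [Tile.shift]
  rwa [add_assoc, ← succ_nsmul]

/-- The tilt relation is inherited by an earlier configuration. -/
theorem Tilt.of_iterate {C C' : Config B G} {d : Dir} (n : ℕ)
    (h : Tilt d ((Config.step d)^[n] C) C') : Tilt d C C' := by
  obtain ⟨⟨m, hm⟩, hs⟩ := h
  exact ⟨⟨m + n, by rw [Function.iterate_add_apply, hm]⟩, hs⟩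

/-- A tilt in which the piece `q` leaves the board and all others stay. -/
theorem tilt_exit {C : Config B G} {F : ι → Set (Tile L)} {d : Dir} {q : ι} {T : ℕ}
    (hC : C.polys = pieces F) (hF : ∀ i, i ≠ q → ∀ s ∈ F i, ∀ t ∈ F q, ∀ n ≤ T,
      Far s.pos (t.pos + n • d.vec))
    (hF' : ∀ i j, i ≠ j → i ≠ q → j ≠ q → ∀ s ∈ F i, ∀ t ∈ F j, Far s.pos t.pos)
    (hhalt : ∀ i, i ≠ q → (F i).Nonempty → ∃ t ∈ F i, t.pos + d.vec ∈ B.blocked)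
    (hpath : ∀ t ∈ F q, ∀ n, 0 < n → n ≤ T → t.pos + n • d.vec ∈ B.openLocs)
    (hexit : ∃ t ∈ F q, t.pos + (T + 1) • d.vec ∉ B.region)
    (hexit' : ∀ t ∈ F q, t.pos + (T + 1) • d.vec ∉ B.blocked) :
    ∃ C' : Config B G, Tilt d C C' ∧
      ∀ F' : ι → Set (Tile L), F' q = ∅ → (∀ i, i ≠ q → F' i = F i) → C'.polys = pieces F' := by
  classical
  let m : ι → ℕ := fun i => if i = q then T else 0
  have mq : m q = T := if_pos rfl
  have mi : ∀ i, i ≠ q → m i = 0 := fun i hi => if_neg hi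
  have hr : Runs B d m F T := by
    refine ⟨fun i t ht n h0 hn => ?_, fun i hi hne => ?_⟩
    · by_cases hiq : i = q
      · subst hiq
        exact hpath t ht n h0 (by omega)
      · rw [mi i hiq] at hn; omega
    · by_cases hiq : i = q
      · subst hiq; omega
      · rw [mi i hiq]
        simpa using hhalt i hiq hne
  have sq : ∀ n ≤ T, slid d m F n q = Tile.shift (n • d.vec) '' F q := by
    intro n hn
    simp only [slid, mq, min_eq_left hn]
  have si : ∀ n, ∀ i, i ≠ q → slid d m F n i = F i := by
    intro n i hi
    simp [slid, mi i hi, shift_zero]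
  have hap : ∀ n ≤ T, Apart (slid d m F n) := by
    intro n hn i j hij s hs t ht
    by_cases hiq : i = q
    · subst hiq
      rw [sq n hn] at hs
      rw [si n j (Ne.symm hij)] at ht
      obtain ⟨s, hs, rfl⟩ := hs
      exact (hF j (Ne.symm hij) t ht s hs n hn).symm
    · rw [si n i hiq] at hs
      by_cases hjq : j = q
      · subst hjq
        rw [sq n hn] at ht
        obtain ⟨t, ht, rfl⟩ := ht
        exact hF i hiq s hs t ht n hn
      · rw [si n j hjq] at ht
        exact hF' i j hij hiq hjq s hs t ht
  have hC1 := iterate_slid hC hr hap T le_rfl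
  let E : ι → Set (Tile L) := fun i => if i = q then ∅ else F i
  have Eq : E q = ∅ := if_pos rfl
  have Ei : ∀ i, i ≠ q → E i = F i := fun i hi => if_neg hi
  have hE : Apart E := by
    intro i j hij s hs t ht
    by_cases hiq : i = q
    · subst hiq; rw [Eq] at hs; exact hs.elim
    · by_cases hjq : j = q
      · subst hjq; rw [Eq] at ht; exact ht.elim
      · rw [Ei i hiq] at hs
        rw [Ei j hjq] at ht
        exact hF' i j hij hiq hjq s hs t ht
  -- After `T` steps inside the board, step `T + 1` carries a tile of `q` over the edge, and the
  -- whole piece is removed.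
  have hC2 : ((Config.step d)^[T + 1] C).polys = pieces E := by
    rw [Function.iterate_succ_apply']
    refine step_pieces hC1 (hap T le_rfl) hE ?_
    intro i
    by_cases hiq : i = q
    · subst hiq
      right
      rw [sq T le_rfl, Eq]
      refine ⟨?_, Or.inr ⟨rfl, ?_⟩⟩
      · rintro _ ⟨t, ht, rfl⟩
        simp only [Tile.shift]
        rw [add_assoc, ← succ_nsmul]
        exact hexit' t ht
      · obtain ⟨t, ht, hx⟩ := hexit
        refine ⟨_, ⟨t, ht, rfl⟩, ?_⟩
        simp only [Tile.shift]
        rwa [add_assoc, ← succ_nsmul]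
    · rw [si T i hiq, Ei i hiq]
      rcases (F i).eq_empty_or_nonempty with he | hne
      · right; simp [he]
      · exact Or.inl ⟨hhalt i hiq hne, rfl⟩
  refine ⟨_, ⟨⟨T + 1, rfl⟩, step_eq_self hC2 ?_⟩, ?_⟩
  · intro i hi
    by_cases hiq : i = q
    · subst hiq; rw [Eq] at hi; exact absurd hi Set.not_nonempty_empty
    · rw [Ei i hiq] at hi ⊢
      exact hhalt i hiq hi
  · intro F' h1 h2
    rw [hC2]
    congr 1
    funext i
    by_cases hiq : i = q
    · subst hiq; rw [Eq, h1]
    · rw [Ei i hiq, h2 i hiq]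

/-- A tilt in which the piece `q` meets the piece `p` at time `T`, and no other pieces meet. -/
theorem tilt_unite {C : Config B G} {F : ι → Set (Tile L)} {d : Dir} {m : ι → ℕ} {T T' : ℕ}
    {p q : ι} (hpq : p ≠ q) (hC : C.polys = pieces F) (hT' : ∀ i, m i ≤ T') (hT0 : 0 < T)
    (hTT : T ≤ T') (hp : m p ≤ T) (hq : m q = T)
    (hqne : (F q).Nonempty)
    (hpath : ∀ i, ∀ t ∈ F i, ∀ n, 0 < n → n ≤ m i → t.pos + n • d.vec ∈ B.openLocs)
    (hhalt : ∀ i, i ≠ q → (F i).Nonempty → ∃ t ∈ F i, t.pos + (m i + 1) • d.vec ∈ B.blocked)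
    (hfar : ∀ i j, i ≠ j → ¬ (i = p ∧ j = q) → ¬ (i = q ∧ j = p) → ∀ s ∈ F i, ∀ t ∈ F j,
      ∀ n ≤ m i, ∀ n' ≤ m j, Far (s.pos + n • d.vec) (t.pos + n' • d.vec))
    (hpqfar : ∀ s ∈ F p, ∀ t ∈ F q, ∀ n < T,
      Far (s.pos + min n (m p) • d.vec) (t.pos + n • d.vec))
    (htouch : Touch G (Tile.shift (m p • d.vec) '' F p) (Tile.shift (m q • d.vec) '' F q)) :
    ∃ C' : Config B G, Tilt d C C' ∧
      C'.polys = pieces (unite (fun i => Tile.shift (m i • d.vec) '' F i) p q) := by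
  have farT : ∀ n, ∀ i j, i ≠ j → ¬ (i = p ∧ j = q) → ¬ (i = q ∧ j = p) →
      ∀ s ∈ slid d m F n i, ∀ t ∈ slid d m F n j, Far s.pos t.pos := by
    rintro n i j hij h1 h2 _ ⟨s, hs, rfl⟩ _ ⟨t, ht, rfl⟩
    exact hfar i j hij h1 h2 s hs t ht _ (min_le_right _ _) _ (min_le_right _ _)
  have hap : ∀ n < T, Apart (slid d m F n) := by
    intro n hn i j hij s hs t ht
    by_cases h1 : i = p ∧ j = q
    · obtain ⟨rfl, rfl⟩ := h1
      obtain ⟨s, hs, rfl⟩ := hs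
      obtain ⟨t, ht, rfl⟩ := ht
      have := hpqfar s hs t ht n hn
      simpa [Tile.shift, min_eq_left (show n ≤ m j by omega)] using this
    · by_cases h2 : i = q ∧ j = p
      · obtain ⟨rfl, rfl⟩ := h2
        obtain ⟨s, hs, rfl⟩ := hs
        obtain ⟨t, ht, rfl⟩ := ht
        have := (hpqfar t ht s hs n hn).symm
        simpa [Tile.shift, min_eq_left (show n ≤ m i by omega)] using this
      · exact farT n i j hij h1 h2 s hs t ht
  have hrun : Runs B d m F T := by
    refine ⟨hpath, fun i hi hne => hhalt i ?_ hne⟩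
    rintro rfl; omega
  -- Contact occurs exactly in the last of these steps: the first `S` are plain sliding.
  obtain ⟨S, rfl⟩ : ∃ S, T = S + 1 := ⟨T - 1, by omega⟩
  have hC1 := iterate_slid hC ⟨hrun.path, fun i hi => hrun.halt i (by omega)⟩
    (fun n hn => hap n (by omega)) S le_rfl
  have ep : slid d m F (S + 1) p = Tile.shift (m p • d.vec) '' F p := by
    simp only [slid, min_eq_right hp]
  have eq : slid d m F (S + 1) q = Tile.shift (m q • d.vec) '' F q := by
    simp only [slid, hq, min_self]
  have hC2 : ((Config.step d)^[S + 1] C).polys = pieces (unite (slid d m F (S + 1)) p q) := by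
    rw [Function.iterate_succ_apply']
    refine step_unite (r := q) hC1 (hap S (by omega)) hpq (farT (S + 1)) ?_
      (hrun.moves (by omega)) (hqne.image _) ?_
    · rwa [ep, eq]
    · rintro _ ⟨t, ht, rfl⟩
      have := hpath q t ht (S + 1) (by omega) (by omega)
      simp only [Tile.shift, hq, min_eq_left (show S ≤ S + 1 by omega)]
      rw [add_assoc, ← succ_nsmul]
      exact this.2
  classical
  -- The displacements that remain after contact. They vanish for `p` and `q`: the union is held by
  -- the wall that stops `p`, and the other pieces complete their motion by a plain slide.
  let m' : ι → ℕ := fun i => m i - (S + 1)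
  have mp : m' p = 0 := by simp only [m']; omega
  have mq : m' q = 0 := by simp only [m']; omega
  have up : unite (slid d m F (S + 1)) p q p = slid d m F (S + 1) p ∪ slid d m F (S + 1) q := by
    simp [unite]
  have uq : unite (slid d m F (S + 1)) p q q = ∅ := by
    simp [unite, hpq.symm]
  have ui : ∀ i, i ≠ p → i ≠ q → unite (slid d m F (S + 1)) p q i = slid d m F (S + 1) i := by
    intro i h1 h2
    simp [unite, h1, h2]
  have add1 : ∀ (x : ℤ × ℤ) (i : ι) (n : ℕ), x + min (S + 1) (m i) • d.vec + n • d.vec =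
      x + (min (S + 1) (m i) + n) • d.vec := by
    intro x i n
    rw [add_assoc, ← add_nsmul]
  have hfin : ∃ C' : Config B G, Tilt d ((Config.step d)^[S + 1] C) C' ∧
      C'.polys = pieces fun i =>
        Tile.shift (m' i • d.vec) '' unite (slid d m F (S + 1)) p q i := by
    refine tilt_slide (T := T') hC2 ?_ ⟨?_, ?_⟩ ?_
    · intro i
      have := hT' i
      simp only [m']; omega
    · intro i t ht n h0 hn
      by_cases hip : i = p
      · subst hip; omega
      by_cases hiq : i = q
      · subst hiq; omega
      rw [ui i hip hiq] at ht
      obtain ⟨t, ht, rfl⟩ := ht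
      simp only [Tile.shift, add1]
      simp only [m'] at hn
      exact hpath i t ht _ (by omega) (by omega)
    · intro i _ hne
      by_cases hiq : i = q
      · subst hiq; rw [uq] at hne; exact absurd hne Set.not_nonempty_empty
      have hne' : (F i).Nonempty := by
        by_cases hip : i = p
        · subst hip
          obtain ⟨_, ⟨t, ht, rfl⟩, -⟩ := htouch
          exact ⟨_, ht⟩
        · rw [ui i hip hiq] at hne
          exact Set.image_nonempty.1 hne
      obtain ⟨t, ht, hb⟩ := hhalt i hiq hne'
      refine ⟨t.shift (min (S + 1) (m i) • d.vec), ?_, ?_⟩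
      · by_cases hip : i = p
        · subst hip
          rw [up]
          exact Or.inl ⟨t, ht, rfl⟩
        · rw [ui i hip hiq]
          exact ⟨t, ht, rfl⟩
      · simp only [Tile.shift, add1]
        have : min (S + 1) (m i) + (m' i + 1) = m i + 1 := by simp only [m']; omega
        rwa [this]
    · intro n _ i j hij
      -- Each later location is an original one displaced by at most `m i`, so `hfar`, which ranges
      -- over all pairs of displacements, covers the second phase as well.
      have aux : ∀ i, i ≠ p → i ≠ q → ∀ s ∈ slid d m' (unite (slid d m F (S + 1)) p q) n i,
          ∃ s₀ ∈ F i, ∃ n ≤ m i, s.pos = s₀.pos + n • d.vec := by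
        rintro i h1 h2 _ ⟨s, hs, rfl⟩
        rw [ui i h1 h2] at hs
        obtain ⟨s, hs, rfl⟩ := hs
        exact ⟨s, hs, min (S + 1) (m i) + min n (m' i), by simp only [m']; omega, add1 _ _ _⟩
      have auxp : ∀ s ∈ slid d m' (unite (slid d m F (S + 1)) p q) n p,
          ∃ r, (r = p ∨ r = q) ∧ ∃ s₀ ∈ F r, ∃ n ≤ m r, s.pos = s₀.pos + n • d.vec := by
        rintro _ ⟨s, hs, rfl⟩
        rw [up] at hs
        rw [mp]
        rcases hs with ⟨s, hs, rfl⟩ | ⟨s, hs, rfl⟩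
        · exact ⟨p, Or.inl rfl, s, hs, min (S + 1) (m p), min_le_right _ _, by simp [Tile.shift]⟩
        · exact ⟨q, Or.inr rfl, s, hs, min (S + 1) (m q), min_le_right _ _, by simp [Tile.shift]⟩
      have auxq : slid d m' (unite (slid d m F (S + 1)) p q) n q = ∅ := by
        simp [slid, uq]
      intro s hs t ht
      by_cases hiq : i = q
      · subst hiq; rw [auxq] at hs; exact hs.elim
      by_cases hjq : j = q
      · subst hjq; rw [auxq] at ht; exact ht.elim
      by_cases hip : i = p
      · subst hip
        obtain ⟨r, hr, s₀, hs₀, n₁, hn₁, e₁⟩ := auxp s hs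
        obtain ⟨t₀, ht₀, n₂, hn₂, e₂⟩ := aux j hij.symm hjq t ht
        rw [e₁, e₂]
        rcases hr with rfl | rfl
        · exact hfar _ _ hij (fun h => hjq h.2) (fun h => hiq h.1) _ hs₀ _ ht₀ _ hn₁ _ hn₂
        · exact hfar _ _ (Ne.symm hjq) (fun h => hjq h.2) (fun h => hij h.2.symm) _ hs₀ _ ht₀ _
            hn₁ _ hn₂
      · obtain ⟨s₀, hs₀, n₁, hn₁, e₁⟩ := aux i hip hiq s hs
        by_cases hjp : j = p
        · subst hjp
          obtain ⟨r, hr, t₀, ht₀, n₂, hn₂, e₂⟩ := auxp t ht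
          rw [e₁, e₂]
          rcases hr with rfl | rfl
          · exact hfar _ _ hij (fun h => hip h.1) (fun h => hiq h.1) _ hs₀ _ ht₀ _ hn₁ _ hn₂
          · exact hfar _ _ hiq (fun h => hip h.1) (fun h => hiq h.1) _ hs₀ _ ht₀ _ hn₁ _ hn₂
        · obtain ⟨t₀, ht₀, n₂, hn₂, e₂⟩ := aux j hjp hjq t ht
          rw [e₁, e₂]
          exact hfar i j hij (fun h => hip h.1) (fun h => hiq h.1) s₀ hs₀ t₀ ht₀ n₁ hn₁ n₂ hn₂
  obtain ⟨C', hC', hpol⟩ := hfin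
  refine ⟨C', hC'.of_iterate, ?_⟩
  rw [hpol]
  congr 1
  funext i
  by_cases hip : i = p
  · subst hip
    rw [up, mp, ep, eq]
    simp [unite, shift_zero]
  by_cases hiq : i = q
  · subst hiq
    rw [uq]
    simp [unite, hpq.symm]
  rw [ui i hip hiq]
  simp only [unite, hip, hiq, if_false, slid, Set.image_image, shift_shift, ← add_nsmul, m']
  congr 2
  have : min (S + 1) (m i) + (m i - (S + 1)) = m i := by omega
  rw [this]

/-- A configuration with given pieces that are far from each other. -/
theorem exists_config {F : ι → Set (Tile L)} (hF : Apart F) (hfin : (pieces F).Finite)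
    (hP : ∀ i, (F i).Nonempty → IsPolyomino G (F i)) (ho : ∀ i, locs (F i) ⊆ B.openLocs) :
    ∃ C : Config B G, C.polys = pieces F := by
  refine ⟨⟨pieces F, hfin, ?_, ?_, ?_⟩, rfl⟩
  · rintro _ ⟨hi, i, rfl⟩
    exact hP i hi
  · rintro _ ⟨hi, i, rfl⟩ _ ⟨hj, j, rfl⟩ hne
    rw [Set.disjoint_left]
    rintro _ ⟨s, hs, rfl⟩ ⟨t, ht, hst⟩
    exact (hF i j (fun h => hne (by rw [h])) s hs t ht).ne hst.symm
  · rintro _ ⟨_, i, rfl⟩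
    exact ho i

end Dynamics

/-! ### The board -/

/-- The open locations of the board. In this order: a lift at whose lower end tiles leave the board,
the pit for the completed columns, the shaft and the well through which a column gets there, the
tower in which a column is built, the feed of the tower, and the track, which consists of `h` bands
with `M` slots each and a corridor above each band. -/
def IsOpen (h w M : ℕ) (x y : ℤ) : Prop :=
  (x = 4 ∧ 1 ≤ y ∧ y ≤ 2 * h + 4) ∨
  (6 ≤ x ∧ x ≤ w + 7 ∧ 2 ≤ y ∧ y ≤ h + 1) ∨
  (x = w + 6 ∧ y = h + 2) ∨
  (w + 6 ≤ x ∧ x ≤ w + 7 ∧ h + 3 ≤ y ∧ y ≤ 2 * h + 2) ∨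
  (w + 7 ≤ x ∧ x ≤ w + 8 ∧ 2 * h + 3 ≤ y ∧ y ≤ 3 * h + 4) ∨
  (4 ≤ x ∧ x ≤ w + 8 ∧ y = 2 * h + 4) ∨
  (2 ≤ x ∧ x ≤ 4 ∧ y = 2 * h + 2) ∨
  (x = 2 ∧ 2 * h + 2 ≤ y ∧ y ≤ 3 * h + 6) ∨
  (2 ≤ x ∧ x ≤ 4 * M + 2 ∧ y = 3 * h + 6) ∨
  (x = 4 * M + 2 ∧ y = 3 * h + 7) ∨
  (2 ≤ x ∧ x ≤ 4 * M + 2 ∧ 3 * h + 8 ≤ y ∧ y ≤ 9 * h + 7 ∧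
    ((y - 3 * h - 8) % 6 = 0 ∧ (x - 2) % 4 ≠ 3 ∨
      (y - 3 * h - 8) % 6 = 1 ∧ (x - 2) % 2 = 0 ∨
      (y - 3 * h - 8) % 6 = 2 ∧ (x - 2) % 4 ≠ 1 ∨
      (y - 3 * h - 8) % 6 = 3 ∧ x = 2 ∨
      (y - 3 * h - 8) % 6 = 4 ∨
      (y - 3 * h - 8) % 6 = 5 ∧ x = 4 * M + 2))

/-- From this height on only the track matters. Modulo 6, rows 0 to 2 form a band with gaps that
limit each tilt to two steps, row 3 is the entrance from the corridor at the western end, row 4 is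
the corridor, and row 5 links it to the eastern end of the band above. -/
theorem isOpen_upper {h w M : ℕ} {x y : ℤ} (hy : 3 * h + 5 ≤ y) : IsOpen h w M x y ↔
    (x = 2 ∧ y = 3 * h + 5) ∨ (2 ≤ x ∧ x ≤ 4 * M + 2 ∧ y = 3 * h + 6) ∨
    (x = 4 * M + 2 ∧ y = 3 * h + 7) ∨
    (2 ≤ x ∧ x ≤ 4 * M + 2 ∧ 3 * h + 8 ≤ y ∧ y ≤ 9 * h + 7 ∧
    ((y - 3 * h - 8) % 6 = 0 ∧ (x - 2) % 4 ≠ 3 ∨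
      (y - 3 * h - 8) % 6 = 1 ∧ (x - 2) % 2 = 0 ∨
      (y - 3 * h - 8) % 6 = 2 ∧ (x - 2) % 4 ≠ 1 ∨
      (y - 3 * h - 8) % 6 = 3 ∧ x = 2 ∨
      (y - 3 * h - 8) % 6 = 4 ∨
      (y - 3 * h - 8) % 6 = 5 ∧ x = 4 * M + 2)) := by
  unfold IsOpen
  constructor
  · rintro (a | a | a | a | a | a | a | a | a | a | a)
    all_goals first | (exfalso; omega) | skip
    · by_cases e : y = 3 * h + 5
      · left; omega
      · right; left; omega
    · right; left; exact a
    · right; right; left; exact a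
    · right; right; right; exact a
  · rintro (a | a | a | a)
    · iterate 7 right
      left; omega
    · iterate 8 right
      left; omega
    · iterate 9 right
      left; omega
    · iterate 10 right
      exact a

/-- The board. -/
def track (h w M : ℕ) : Board where
  width := 4 * M + 3
  height := 9 * h + 8
  blocked := {p | p ∈ rect (4 * M + 3) (9 * h + 8) ∧ ¬ IsOpen h w M p.1 p.2}
  blocked_subset := fun _ hp => hp.1

theorem mem_region_track {h w M : ℕ} {p : ℤ × ℤ} : p ∈ (track h w M).region ↔
    1 ≤ p.1 ∧ p.1 ≤ 4 * M + 3 ∧ 1 ≤ p.2 ∧ p.2 ≤ 9 * h + 8 := by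
  simp only [Board.region, track, rect, Set.mem_prod, Set.mem_Icc]
  push_cast
  tauto

theorem mem_blocked_track {h w M : ℕ} {p : ℤ × ℤ} : p ∈ (track h w M).blocked ↔
    (1 ≤ p.1 ∧ p.1 ≤ 4 * M + 3 ∧ 1 ≤ p.2 ∧ p.2 ≤ 9 * h + 8) ∧ ¬ IsOpen h w M p.1 p.2 := by
  rw [← mem_region_track (w := w)]
  rfl

theorem IsOpen.bounds {h w M : ℕ} (hw : 0 < w) (hM : 2 * w ≤ M) {x y : ℤ}
    (ho : IsOpen h w M x y) : 1 ≤ x ∧ x ≤ 4 * M + 3 ∧ 1 ≤ y ∧ y ≤ 9 * h + 8 := by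
  unfold IsOpen at ho
  refine ⟨?_, ?_, ?_, ?_⟩ <;> omega

theorem mem_openLocs_track {h w M : ℕ} (hw : 0 < w) (hM : 2 * w ≤ M) {p : ℤ × ℤ} :
    p ∈ (track h w M).openLocs ↔ IsOpen h w M p.1 p.2 := by
  unfold Board.openLocs
  rw [Set.mem_sdiff, mem_blocked_track, mem_region_track]
  constructor
  · rintro ⟨h1, h2⟩
    by_contra hne
    exact h2 ⟨h1, hne⟩
  · intro ho
    exact ⟨ho.bounds hw hM, fun h' => h'.2 ho⟩

/-- A blocked location of the board, in coordinates. -/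
def IsBlocked (h w M : ℕ) (x y : ℤ) : Prop :=
  (1 ≤ x ∧ x ≤ 4 * M + 3 ∧ 1 ≤ y ∧ y ≤ 9 * h + 8) ∧ ¬ IsOpen h w M x y

/-- Two locations given by coordinates are at king distance at least two. -/
def FarXY (x y x' y' : ℤ) : Prop := x + 2 ≤ x' ∨ x' + 2 ≤ x ∨ y + 2 ≤ y' ∨ y' + 2 ≤ y

/-! ### The slots of the track -/

/-- The index of a slot in its band. -/
def slotCol (M s : ℕ) : ℕ := M - 1 - (s - 1) % M

/-- The band of a slot. -/
def slotRow (M s : ℕ) : ℕ := (s - 1) / M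

theorem slotCol_lt {M : ℕ} (hM : 0 < M) (s : ℕ) : slotCol M s < M := by
  unfold slotCol; omega

theorem slotRow_lt {h M s : ℕ} (hM : 0 < M) (hs : 0 < s) (hsK : s < h * M + 1) : slotRow M s < h := by
  unfold slotRow
  rw [Nat.div_lt_iff_lt_mul hM]
  omega

/-- Division of `s - 1` by `M` with remainder. Positivity matters, because truncated subtraction
gives 0 the same coordinates as 1; slot 0 has its own location in `posD`. -/
theorem slot_injective {M s s' : ℕ} (hM : 0 < M) (hs : 0 < s) (hs' : 0 < s')
    (h1 : slotCol M s = slotCol M s') (h2 : slotRow M s = slotRow M s') : s = s' := by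
  unfold slotCol at h1
  unfold slotRow at h2
  have := Nat.mod_lt (s - 1) hM
  have := Nat.mod_lt (s' - 1) hM
  have e : (s - 1) % M = (s' - 1) % M := by omega
  have := Nat.div_add_mod (s - 1) M
  have := Nat.div_add_mod (s' - 1) M
  rw [h2, e] at *
  omega

/-- Passing from a slot to the one before it. -/
theorem slot_pred {M s : ℕ} (hM : 0 < M) (hs : 1 < s) :
    (slotCol M s + 1 = M ∧ slotCol M (s - 1) = 0 ∧ slotRow M s = slotRow M (s - 1) + 1) ∨
    (slotCol M s + 1 < M ∧ slotCol M (s - 1) = slotCol M s + 1 ∧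
      slotRow M (s - 1) = slotRow M s) := by
  unfold slotCol slotRow
  obtain ⟨r, rfl⟩ : ∃ r, s = r + 2 := ⟨s - 2, by omega⟩
  have e1 : r + 2 - 1 = r + 1 := by omega
  have e2 : r + 1 - 1 = r := by omega
  rw [e1, e2]
  have hlt := Nat.mod_lt r hM
  have hdm := Nat.div_add_mod r M
  -- Whether the slot is the first of a new band or lies in the band of its predecessor.
  by_cases hd : r % M + 1 = M
  · left
    have : r + 1 = M * (r / M + 1) := by rw [mul_add]; omega
    rw [this, Nat.mul_mod_right, Nat.mul_div_cancel_left _ hM]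
    omega
  · right
    have : r + 1 = r % M + 1 + M * (r / M) := by omega
    have e3 : (r + 1) % M = r % M + 1 := by
      rw [this, Nat.add_mul_mod_self_left, Nat.mod_eq_of_lt (by omega)]
    have e4 : (r + 1) / M = r / M := by
      rw [this, Nat.add_mul_div_left _ _ hM, Nat.div_eq_of_lt (by omega), zero_add]
    rw [e3, e4]
    omega

theorem slotCol_one {M : ℕ} (hM : 0 < M) : slotCol M 1 + 1 = M := by
  simp [slotCol]; omega

theorem slotRow_one {M : ℕ} : slotRow M 1 = 0 := by
  simp [slotRow]

/-- The location of slot `s` between two cycles of tilts. -/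
def posD (h M s : ℕ) : ℤ × ℤ :=
  if s = 0 then (2, 2 * h + 2) else (2 + 4 * slotCol M s, 3 * h + 8 + 6 * slotRow M s)

/-- The location of slot `s` after the first tilt of a cycle. -/
def posA (h M s : ℕ) : ℤ × ℤ := ((posD h M s).1 + 2, (posD h M s).2)

/-- The location of slot `s` after the second tilt of a cycle. -/
def posB (h M s : ℕ) : ℤ × ℤ := ((posD h M s).1 + 2, (posD h M s).2 + 2)

/-- The location of slot `s` after the third tilt of a cycle. -/
def posC (h w M s : ℕ) : ℤ × ℤ :=
  if s = 0 then (w + 8, 2 * h + 4) else ((posD h M s).1 + 4, (posD h M s).2 + 2)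

/-- The location of slot `s` after the fourth tilt of a cycle. -/
def posE (h w M s : ℕ) : ℤ × ℤ :=
  if s = 0 then (w + 8, 2 * h + 3) else
    ((posD h M s).1 + 4, (posD h M s).2 - if slotCol M s + 1 = M then 2 else 0)

/-- The location of slot `s` after the fifth tilt of a cycle. -/
def posF (h M s : ℕ) : ℤ × ℤ :=
  if slotCol M s + 1 = M then (2, (posD h M s).2 - 2)
  else ((posD h M s).1 + 4, (posD h M s).2)

/-- The tiles in the slots `e, …, K - 1`, at the locations `P`, move by `m` in direction `d` to the
locations `P'`, without meeting; they stay in the track, apart from the front one if `fr` holds. -/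
structure SlotRun (h w M : ℕ) (d : Dir) (fr : Prop) (e K T : ℕ) (P P' : ℕ → ℤ × ℤ)
    (m : ℕ → ℕ) : Prop where
  le : ∀ s, m s ≤ T
  fst_eq : ∀ s, e ≤ s → s < K → (P' s).1 = (P s).1 + m s * d.vec.1
  snd_eq : ∀ s, e ≤ s → s < K → (P' s).2 = (P s).2 + m s * d.vec.2
  path : ∀ s, e ≤ s → s < K → ∀ k : ℤ, 0 ≤ k → k ≤ m s →
    IsOpen h w M ((P s).1 + k * d.vec.1) ((P s).2 + k * d.vec.2)
  halt : ∀ s, e ≤ s → s < K →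
    IsBlocked h w M ((P s).1 + (m s + 1) * d.vec.1) ((P s).2 + (m s + 1) * d.vec.2)
  far : ∀ s s', e ≤ s → s < s' → s' < K → ∀ k k' : ℤ, 0 ≤ k → k ≤ m s → 0 ≤ k' → k' ≤ m s' →
    FarXY ((P s).1 + k * d.vec.1) ((P s).2 + k * d.vec.2)
      ((P s').1 + k' * d.vec.1) ((P s').2 + k' * d.vec.2)
  clear : ∀ s, e ≤ s → s < K → ∀ k : ℤ, 0 ≤ k → k ≤ m s →
    3 * h + 6 ≤ (P s).2 + k * d.vec.2 ∨ (P s).1 + k * d.vec.1 ≤ 4 ∨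
      s = 0 ∧ fr ∧ 2 * h + 3 ≤ (P s).2 + k * d.vec.2 ∧ (P s).2 + k * d.vec.2 ≤ 2 * h + 4

/-! ### The motion of the queue under each tilt -/

section

variable {h w M : ℕ}

/-- Different slots are different points of a grid with spacing 4 by 6. Together with the
displacements of a tilt this is what separates tiles in the track. -/
theorem slot_far {K s s' : ℕ} (hK : K ≤ h * M) (hM : 0 < M) (hs : 0 < s) (hs' : s < s') (hsK : s' < K) :
    slotCol M s < M ∧ slotCol M s' < M ∧ slotRow M s < h ∧ slotRow M s' < h ∧
    (slotCol M s ≠ slotCol M s' ∨ slotRow M s ≠ slotRow M s') := by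
  refine ⟨slotCol_lt hM s, slotCol_lt hM s', slotRow_lt hM hs (by omega),
    slotRow_lt hM (by omega) (by omega), ?_⟩
  by_contra! hne
  have := slot_injective hM hs (by omega) hne.1 hne.2
  omega

-- The lowest row of a band lacks every fourth point, just west of each slot, so a tile advances two
-- steps and stops. The front tile reaches the lift at `x = 4`.
set_option maxHeartbeats 2000000 in
theorem slotRun_DA {e K : ℕ} (hw : 0 < w) (hM : 2 * w ≤ M) (hK : K ≤ h * M) :
    SlotRun h w M .E False e K 2 (posD h M) (posA h M)
      fun _ => 2 := by
  have hM0 : 0 < M := by omega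
  refine ⟨?_, ?_, ?_, ?_, ?_, ?_, ?_⟩
  · intro _
    omega
  · intro s hse hs
    rcases Nat.eq_zero_or_pos s with rfl | h0
    · simp only [posA, posD, if_true, Dir.vec]; omega
    · simp only [posA, posD, h0.ne', if_false, Dir.vec]
      omega
  · intro s hse hs
    rcases Nat.eq_zero_or_pos s with rfl | h0
    · simp only [posA, posD, if_true, Dir.vec]; omega
    · simp only [posA, posD, h0.ne', if_false, Dir.vec]
      omega
  · intro s hse hs k hk0 hk
    rcases Nat.eq_zero_or_pos s with rfl | h0
    · simp only [posD, if_true, Dir.vec, IsOpen]; omega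
    · have h1 := slotCol_lt hM0 s
      have h2 := slotRow_lt hM0 h0 (show s < h * M + 1 by omega)
      simp only [posD, h0.ne', if_false, Dir.vec]
      rw [isOpen_upper (by omega)]
      omega
  · intro s hse hs
    rcases Nat.eq_zero_or_pos s with rfl | h0
    · simp only [posD, if_true, Dir.vec, IsOpen, IsBlocked]; omega
    · simp only [posD, h0.ne', if_false, Dir.vec, IsBlocked]
      have h1 := slotCol_lt hM0 s
      have h2 := slotRow_lt hM0 h0 (show s < h * M + 1 by omega)
      rw [isOpen_upper (by omega)]
      omega
  · intro s s' hse hss hs k k' hk0 hk hk0' hk'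
    have h0' : s' ≠ 0 := by omega
    rcases Nat.eq_zero_or_pos s with rfl | h0
    · simp only [posD, if_true, h0', if_false, Dir.vec, FarXY]
      omega
    · have h5 := slot_far hK hM0 h0 hss hs
      simp only [posD, h0.ne', if_false, h0', Dir.vec, FarXY]
      omega
  · intro s hse hs k hk0 hk
    rcases Nat.eq_zero_or_pos s with rfl | h0
    · simp only [posD, if_true, Dir.vec]; omega
    · simp only [posD, h0.ne', if_false, Dir.vec]
      omega

-- The tiles now stand in even columns other than `x = 2`, where the middle row is open and row 3 is
-- closed. The front tile rises to the end of the lift, level with the feed.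
set_option maxHeartbeats 2000000 in
theorem slotRun_AB {e K : ℕ} (hw : 0 < w) (hM : 2 * w ≤ M) (hK : K ≤ h * M) :
    SlotRun h w M .N False e K 2 (posA h M) (posB h M)
      fun _ => 2 := by
  have hM0 : 0 < M := by omega
  refine ⟨?_, ?_, ?_, ?_, ?_, ?_, ?_⟩
  · intro _
    omega
  · intro s hse hs
    rcases Nat.eq_zero_or_pos s with rfl | h0
    · simp only [posA, posB, posD, if_true, Dir.vec]; omega
    · simp only [posA, posB, posD, h0.ne', if_false, Dir.vec]
      omega
  · intro s hse hs
    rcases Nat.eq_zero_or_pos s with rfl | h0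
    · simp only [posA, posB, posD, if_true, Dir.vec]; omega
    · simp only [posA, posB, posD, h0.ne', if_false, Dir.vec]
      omega
  · intro s hse hs k hk0 hk
    rcases Nat.eq_zero_or_pos s with rfl | h0
    · simp only [posA, posD, if_true, Dir.vec, IsOpen]; omega
    · have h1 := slotCol_lt hM0 s
      have h2 := slotRow_lt hM0 h0 (show s < h * M + 1 by omega)
      simp only [posA, posD, h0.ne', if_false, Dir.vec]
      rw [isOpen_upper (by omega)]
      omega
  · intro s hse hs
    rcases Nat.eq_zero_or_pos s with rfl | h0
    · simp only [posA, posD, if_true, Dir.vec, IsOpen, IsBlocked]; omega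
    · simp only [posA, posD, h0.ne', if_false, Dir.vec, IsBlocked]
      have h1 := slotCol_lt hM0 s
      have h2 := slotRow_lt hM0 h0 (show s < h * M + 1 by omega)
      rw [isOpen_upper (by omega)]
      omega
  · intro s s' hse hss hs k k' hk0 hk hk0' hk'
    have h0' : s' ≠ 0 := by omega
    rcases Nat.eq_zero_or_pos s with rfl | h0
    · simp only [posA, posD, if_true, h0', if_false, Dir.vec, FarXY]
      omega
    · have h5 := slot_far hK hM0 h0 hss hs
      simp only [posA, posD, h0.ne', if_false, h0', Dir.vec, FarXY]
      omega
  · intro s hse hs k hk0 hk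
    rcases Nat.eq_zero_or_pos s with rfl | h0
    · simp only [posA, posD, if_true, Dir.vec]; omega
    · simp only [posA, posD, h0.ne', if_false, Dir.vec]
      omega

-- The gaps of the top row are shifted against those of the lowest row, so the tiles gain another
-- two steps. The front tile runs through the whole feed, from `x = 4` to `x = w + 8`, and enters
-- the zone of the column.
set_option maxHeartbeats 2000000 in
theorem slotRun_BC {e K : ℕ} (hw : 0 < w) (hM : 2 * w ≤ M) (hK : K ≤ h * M) :
    SlotRun h w M .E True e K (w + 4) (posB h M) (posC h w M)
      fun s => if s = 0 then w + 4 else 2 := by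
  have hM0 : 0 < M := by omega
  refine ⟨?_, ?_, ?_, ?_, ?_, ?_, ?_⟩
  · intro s
    split_ifs <;> omega
  · intro s hse hs
    rcases Nat.eq_zero_or_pos s with rfl | h0
    · simp only [posC, posB, posD, if_true, Dir.vec]; omega
    · simp only [posC, posB, posD, h0.ne', if_false, Dir.vec]
      omega
  · intro s hse hs
    rcases Nat.eq_zero_or_pos s with rfl | h0
    · simp only [posC, posB, posD, if_true, Dir.vec]; omega
    · simp only [posC, posB, posD, h0.ne', if_false, Dir.vec]
      omega
  · intro s hse hs k hk0 hk
    rcases Nat.eq_zero_or_pos s with rfl | h0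
    · simp only [if_true] at hk
      simp only [posB, posD, if_true, Dir.vec, IsOpen]; omega
    · simp only [h0.ne', if_false] at hk
      have h1 := slotCol_lt hM0 s
      have h2 := slotRow_lt hM0 h0 (show s < h * M + 1 by omega)
      simp only [posB, posD, h0.ne', if_false, Dir.vec]
      rw [isOpen_upper (by omega)]
      omega
  · intro s hse hs
    rcases Nat.eq_zero_or_pos s with rfl | h0
    · simp only [posB, posD, if_true, Dir.vec, IsOpen, IsBlocked]; omega
    · simp only [posB, posD, h0.ne', if_false, Dir.vec, IsBlocked]
      have h1 := slotCol_lt hM0 s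
      have h2 := slotRow_lt hM0 h0 (show s < h * M + 1 by omega)
      rw [isOpen_upper (by omega)]
      omega
  · intro s s' hse hss hs k k' hk0 hk hk0' hk'
    have h0' : s' ≠ 0 := by omega
    rcases Nat.eq_zero_or_pos s with rfl | h0
    · simp only [if_true, h0', if_false] at hk hk'
      simp only [posB, posD, if_true, h0', if_false, Dir.vec, FarXY]
      omega
    · simp only [h0.ne', if_false, h0'] at hk hk'
      have h5 := slot_far hK hM0 h0 hss hs
      simp only [posB, posD, h0.ne', if_false, h0', Dir.vec, FarXY]
      omega
  · intro s hse hs k hk0 hk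
    rcases Nat.eq_zero_or_pos s with rfl | h0
    · simp only [if_true] at hk
      simp only [posB, posD, if_true, Dir.vec, true_and]; omega
    · simp only [h0.ne', if_false] at hk
      simp only [posB, posD, h0.ne', if_false, Dir.vec]
      omega

-- The tiles fall back to the lowest row, one slot further east. Below it only `x = 4 * M + 2` is
-- open, so precisely the last tile of each band falls two rows more, into the corridor. The front
-- tile sinks by one to the floor of the tower.
set_option maxHeartbeats 2000000 in
theorem slotRun_CE {e K : ℕ} (hw : 0 < w) (hM : 2 * w ≤ M) (hK : K ≤ h * M) :
    SlotRun h w M .S True e K 4 (posC h w M) (posE h w M)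
      fun s => if s = 0 then 1 else if slotCol M s + 1 = M then 4 else 2 := by
  have hM0 : 0 < M := by omega
  refine ⟨?_, ?_, ?_, ?_, ?_, ?_, ?_⟩
  · intro s
    split_ifs <;> omega
  · intro s hse hs
    rcases Nat.eq_zero_or_pos s with rfl | h0
    · simp only [posC, posE, posD, if_true, Dir.vec]; omega
    · simp only [posC, posE, posD, h0.ne', if_false, Dir.vec]
      split_ifs <;> omega
  · intro s hse hs
    rcases Nat.eq_zero_or_pos s with rfl | h0
    · simp only [posC, posE, posD, if_true, Dir.vec]; omega
    · simp only [posC, posE, posD, h0.ne', if_false, Dir.vec]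
      split_ifs <;> omega
  · intro s hse hs k hk0 hk
    rcases Nat.eq_zero_or_pos s with rfl | h0
    · simp only [if_true] at hk
      simp only [posC, posD, if_true, Dir.vec, IsOpen]; omega
    · simp only [h0.ne', if_false] at hk
      have h1 := slotCol_lt hM0 s
      have h2 := slotRow_lt hM0 h0 (show s < h * M + 1 by omega)
      simp only [posC, posD, h0.ne', if_false, Dir.vec]
      split_ifs at hk ⊢ <;> (rw [isOpen_upper (by omega)]; omega)
  · intro s hse hs
    rcases Nat.eq_zero_or_pos s with rfl | h0
    · simp only [posC, posD, if_true, Dir.vec, IsOpen, IsBlocked]; omega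
    · simp only [posC, posD, h0.ne', if_false, Dir.vec, IsBlocked]
      have h1 := slotCol_lt hM0 s
      have h2 := slotRow_lt hM0 h0 (show s < h * M + 1 by omega)
      split_ifs <;> (rw [isOpen_upper (by omega)]; omega)
  · intro s s' hse hss hs k k' hk0 hk hk0' hk'
    have h0' : s' ≠ 0 := by omega
    rcases Nat.eq_zero_or_pos s with rfl | h0
    · simp only [if_true, h0', if_false] at hk hk'
      simp only [posC, posD, if_true, h0', if_false, Dir.vec, FarXY]
      split_ifs at hk' ⊢ <;> omega
    · simp only [h0.ne', if_false, h0'] at hk hk'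
      have h5 := slot_far hK hM0 h0 hss hs
      simp only [posC, posD, h0.ne', if_false, h0', Dir.vec, FarXY]
      split_ifs at hk hk' ⊢ <;> omega
  · intro s hse hs k hk0 hk
    rcases Nat.eq_zero_or_pos s with rfl | h0
    · simp only [if_true] at hk
      simp only [posC, posD, if_true, Dir.vec, true_and]; omega
    · simp only [h0.ne', if_false] at hk
      simp only [posC, posD, h0.ne', if_false, Dir.vec]
      split_ifs at hk ⊢ <;> omega

-- The gap west of each slot holds the tiles in the bands, while those in the corridors travel the
-- full length `4 * M`. Slot 0 is excluded because its tile has been attached or discarded by now.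
set_option maxHeartbeats 2000000 in
theorem slotRun_EF {K : ℕ} (hw : 0 < w) (hM : 2 * w ≤ M) (hK : K ≤ h * M) :
    SlotRun h w M .W False 1 K (4 * M) (posE h w M) (posF h M)
      fun s => if slotCol M s + 1 = M then 4 * M else 0 := by
  have hM0 : 0 < M := by omega
  refine ⟨?_, ?_, ?_, ?_, ?_, ?_, ?_⟩
  · intro s
    split_ifs <;> omega
  · intro s hse hs
    rcases Nat.eq_zero_or_pos s with rfl | h0
    · omega
    · simp only [posE, posF, posD, h0.ne', if_false, Dir.vec]
      split_ifs <;> omega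
  · intro s hse hs
    rcases Nat.eq_zero_or_pos s with rfl | h0
    · omega
    · simp only [posE, posF, posD, h0.ne', if_false, Dir.vec]
      split_ifs <;> omega
  · intro s hse hs k hk0 hk
    rcases Nat.eq_zero_or_pos s with rfl | h0
    · omega
    · have h1 := slotCol_lt hM0 s
      have h2 := slotRow_lt hM0 h0 (show s < h * M + 1 by omega)
      simp only [posE, posD, h0.ne', if_false, Dir.vec]
      split_ifs at hk ⊢ <;> (rw [isOpen_upper (by omega)]; omega)
  · intro s hse hs
    rcases Nat.eq_zero_or_pos s with rfl | h0
    · omega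
    · simp only [posE, posD, h0.ne', if_false, Dir.vec, IsBlocked]
      have h1 := slotCol_lt hM0 s
      have h2 := slotRow_lt hM0 h0 (show s < h * M + 1 by omega)
      split_ifs <;> (rw [isOpen_upper (by omega)]; omega)
  · intro s s' hse hss hs k k' hk0 hk hk0' hk'
    have h0' : s' ≠ 0 := by omega
    rcases Nat.eq_zero_or_pos s with rfl | h0
    · omega
    · have h5 := slot_far hK hM0 h0 hss hs
      simp only [posE, posD, h0.ne', if_false, h0', Dir.vec, FarXY]
      split_ifs at hk hk' ⊢ <;> omega
  · intro s hse hs k hk0 hk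
    rcases Nat.eq_zero_or_pos s with rfl | h0
    · omega
    · simp only [posE, posD, h0.ne', if_false, Dir.vec]
      split_ifs at hk ⊢ <;> omega

-- Tiles at the western ends of corridors fall four rows into the first slot of the band below. From
-- the lowest corridor, at height `3 * h + 6`, the fall of `h + 4` ends at the front location. All
-- in all slot `s` has become slot `s - 1`.
set_option maxHeartbeats 2000000 in
theorem slotRun_FD {K : ℕ} (hw : 0 < w) (hM : 2 * w ≤ M) (hK : K ≤ h * M) :
    SlotRun h w M .S False 1 K (h + 4) (posF h M) (fun s => posD h M (s - 1))
      fun s => if slotCol M s + 1 = M then (if s = 1 then h + 4 else 4) else 0 := by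
  have hM0 : 0 < M := by omega
  have one := slotCol_one hM0
  have one' : slotRow M 1 = 0 := slotRow_one
  refine ⟨?_, ?_, ?_, ?_, ?_, ?_, ?_⟩
  · intro s
    split_ifs <;> omega
  · intro s hs1 hs
    rcases hs1.eq_or_lt with rfl | hs1
    · simp [posD, posF, one, Dir.vec]
    · have h5 := slot_pred hM0 hs1
      simp only [posD, posF, (show s - 1 ≠ 0 by omega), (show s ≠ 0 by omega), if_false, Dir.vec]
      split_ifs <;> omega
  · intro s hs1 hs
    rcases hs1.eq_or_lt with rfl | hs1
    · simp [posD, posF, one, one', Dir.vec]; omega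
    · have h5 := slot_pred hM0 hs1
      simp only [posD, posF, (show s - 1 ≠ 0 by omega), (show s ≠ 0 by omega),
        (show s ≠ 1 by omega), if_false, Dir.vec]
      split_ifs <;> omega
  · intro s hs1 hs k hk0 hk
    rcases hs1.eq_or_lt with rfl | hs1
    · simp only [one, if_true] at hk
      simp only [posD, posF, one, one', if_true, one_ne_zero, if_false, Dir.vec, IsOpen]; omega
    · have h1 := slotCol_lt hM0 s
      have h2 := slotRow_lt hM0 (by omega) (show s < h * M + 1 by omega)
      have h5 := slot_pred hM0 hs1
      simp only [(show s ≠ 1 by omega), if_false] at hk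
      simp only [posF, posD, (show s ≠ 0 by omega), if_false, Dir.vec]
      split_ifs at hk ⊢ <;> (rw [isOpen_upper (by omega)]; omega)
  · intro s hs1 hs
    rcases hs1.eq_or_lt with rfl | hs1
    · simp only [posD, posF, one, one', if_true, one_ne_zero, if_false, Dir.vec, IsOpen,
        IsBlocked]
      omega
    · have h1 := slotCol_lt hM0 s
      have h2 := slotRow_lt hM0 (by omega) (show s < h * M + 1 by omega)
      have h5 := slot_pred hM0 hs1
      simp only [posF, posD, (show s ≠ 0 by omega), (show s ≠ 1 by omega), if_false, Dir.vec,
        IsBlocked]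
      split_ifs <;> (rw [isOpen_upper (by omega)]; omega)
  · intro s s' hse hss hs k k' hk0 hk hk0' hk'
    have h5 := slot_far hK hM0 hse hss hs
    have h6 := slot_pred hM0 (show 1 < s' by omega)
    simp only [(show s' ≠ 1 by omega), if_false] at hk'
    simp only [posF, posD, (show s ≠ 0 by omega), (show s' ≠ 0 by omega), if_false, Dir.vec, FarXY]
    rcases hse.eq_or_lt with rfl | hs1
    · rw [one, one'] at *
      simp only [if_true] at hk
      split_ifs at hk' ⊢ <;> omega
    · simp only [(show s ≠ 1 by omega), if_false] at hk
      split_ifs at hk hk' ⊢ <;> omega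
  · intro s hs1 hs k hk0 hk
    simp only [posF, posD, (show s ≠ 0 by omega), if_false, Dir.vec]
    split_ifs at hk ⊢ <;> omega

-- This and the next three lemmas serve the transfer and the discarding, which must not advance the
-- queue. Here each slot has a blocked point to its west.
set_option maxHeartbeats 2000000 in
theorem slotRun_D_W {e K : ℕ} (hw : 0 < w) (hM : 2 * w ≤ M) (hK : K ≤ h * M) :
    SlotRun h w M .W False e K 0 (posD h M) (posD h M)
      fun _ => 0 := by
  have hM0 : 0 < M := by omega
  refine ⟨?_, ?_, ?_, ?_, ?_, ?_, ?_⟩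
  · intro _
    omega
  · intro s hse hs
    rcases Nat.eq_zero_or_pos s with rfl | h0
    · simp only [posD, if_true, Dir.vec]; omega
    · simp only [posD, h0.ne', if_false, Dir.vec]
      omega
  · intro s hse hs
    rcases Nat.eq_zero_or_pos s with rfl | h0
    · simp only [posD, if_true, Dir.vec]; omega
    · simp only [posD, h0.ne', if_false, Dir.vec]
      omega
  · intro s hse hs k hk0 hk
    rcases Nat.eq_zero_or_pos s with rfl | h0
    · simp only [posD, if_true, Dir.vec, IsOpen]; omega
    · have h1 := slotCol_lt hM0 s
      have h2 := slotRow_lt hM0 h0 (show s < h * M + 1 by omega)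
      simp only [posD, h0.ne', if_false, Dir.vec]
      rw [isOpen_upper (by omega)]
      omega
  · intro s hse hs
    rcases Nat.eq_zero_or_pos s with rfl | h0
    · simp only [posD, if_true, Dir.vec, IsOpen, IsBlocked]; omega
    · simp only [posD, h0.ne', if_false, Dir.vec, IsBlocked]
      have h1 := slotCol_lt hM0 s
      have h2 := slotRow_lt hM0 h0 (show s < h * M + 1 by omega)
      rw [isOpen_upper (by omega)]
      omega
  · intro s s' hse hss hs k k' hk0 hk hk0' hk'
    have h0' : s' ≠ 0 := by omega
    rcases Nat.eq_zero_or_pos s with rfl | h0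
    · simp only [posD, if_true, h0', if_false, Dir.vec, FarXY]
      omega
    · have h5 := slot_far hK hM0 h0 hss hs
      simp only [posD, h0.ne', if_false, h0', Dir.vec, FarXY]
      omega
  · intro s hse hs k hk0 hk
    rcases Nat.eq_zero_or_pos s with rfl | h0
    · simp only [posD, if_true, Dir.vec]; omega
    · simp only [posD, h0.ne', if_false, Dir.vec]
      omega

-- The only opening below a band is at its eastern end, beyond the last slot. The run has zero
-- length, so it also certifies that the resting queue is separated.
set_option maxHeartbeats 2000000 in
theorem slotRun_D_S {e K : ℕ} (hw : 0 < w) (hM : 2 * w ≤ M) (hK : K ≤ h * M) :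
    SlotRun h w M .S False e K 0 (posD h M) (posD h M)
      fun _ => 0 := by
  have hM0 : 0 < M := by omega
  refine ⟨?_, ?_, ?_, ?_, ?_, ?_, ?_⟩
  · intro _
    omega
  · intro s hse hs
    rcases Nat.eq_zero_or_pos s with rfl | h0
    · simp only [posD, if_true, Dir.vec]; omega
    · simp only [posD, h0.ne', if_false, Dir.vec]
      omega
  · intro s hse hs
    rcases Nat.eq_zero_or_pos s with rfl | h0
    · simp only [posD, if_true, Dir.vec]; omega
    · simp only [posD, h0.ne', if_false, Dir.vec]
      omega
  · intro s hse hs k hk0 hk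
    rcases Nat.eq_zero_or_pos s with rfl | h0
    · simp only [posD, if_true, Dir.vec, IsOpen]; omega
    · have h1 := slotCol_lt hM0 s
      have h2 := slotRow_lt hM0 h0 (show s < h * M + 1 by omega)
      simp only [posD, h0.ne', if_false, Dir.vec]
      rw [isOpen_upper (by omega)]
      omega
  · intro s hse hs
    rcases Nat.eq_zero_or_pos s with rfl | h0
    · simp only [posD, if_true, Dir.vec, IsOpen, IsBlocked]; omega
    · simp only [posD, h0.ne', if_false, Dir.vec, IsBlocked]
      have h1 := slotCol_lt hM0 s
      have h2 := slotRow_lt hM0 h0 (show s < h * M + 1 by omega)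
      rw [isOpen_upper (by omega)]
      omega
  · intro s s' hse hss hs k k' hk0 hk hk0' hk'
    have h0' : s' ≠ 0 := by omega
    rcases Nat.eq_zero_or_pos s with rfl | h0
    · simp only [posD, if_true, h0', if_false, Dir.vec, FarXY]
      omega
    · have h5 := slot_far hK hM0 h0 hss hs
      simp only [posD, h0.ne', if_false, h0', Dir.vec, FarXY]
      omega
  · intro s hse hs k hk0 hk
    rcases Nat.eq_zero_or_pos s with rfl | h0
    · simp only [posD, if_true, Dir.vec]; omega
    · simp only [posD, h0.ne', if_false, Dir.vec]
      omega

-- The reverse of the first tilt of a cycle: it cancels the E within a transfer.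
set_option maxHeartbeats 2000000 in
theorem slotRun_AD {e K : ℕ} (hw : 0 < w) (hM : 2 * w ≤ M) (hK : K ≤ h * M) :
    SlotRun h w M .W False e K 2 (posA h M) (posD h M)
      fun _ => 2 := by
  have hM0 : 0 < M := by omega
  refine ⟨?_, ?_, ?_, ?_, ?_, ?_, ?_⟩
  · intro _
    omega
  · intro s hse hs
    rcases Nat.eq_zero_or_pos s with rfl | h0
    · simp only [posA, posD, if_true, Dir.vec]; omega
    · simp only [posA, posD, h0.ne', if_false, Dir.vec]
      omega
  · intro s hse hs
    rcases Nat.eq_zero_or_pos s with rfl | h0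
    · simp only [posA, posD, if_true, Dir.vec]; omega
    · simp only [posA, posD, h0.ne', if_false, Dir.vec]
      omega
  · intro s hse hs k hk0 hk
    rcases Nat.eq_zero_or_pos s with rfl | h0
    · simp only [posA, posD, if_true, Dir.vec, IsOpen]; omega
    · have h1 := slotCol_lt hM0 s
      have h2 := slotRow_lt hM0 h0 (show s < h * M + 1 by omega)
      simp only [posA, posD, h0.ne', if_false, Dir.vec]
      rw [isOpen_upper (by omega)]
      omega
  · intro s hse hs
    rcases Nat.eq_zero_or_pos s with rfl | h0
    · simp only [posA, posD, if_true, Dir.vec, IsOpen, IsBlocked]; omega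
    · simp only [posA, posD, h0.ne', if_false, Dir.vec, IsBlocked]
      have h1 := slotCol_lt hM0 s
      have h2 := slotRow_lt hM0 h0 (show s < h * M + 1 by omega)
      rw [isOpen_upper (by omega)]
      omega
  · intro s s' hse hss hs k k' hk0 hk hk0' hk'
    have h0' : s' ≠ 0 := by omega
    rcases Nat.eq_zero_or_pos s with rfl | h0
    · simp only [posA, posD, if_true, h0', if_false, Dir.vec, FarXY]
      omega
    · have h5 := slot_far hK hM0 h0 hss hs
      simp only [posA, posD, h0.ne', if_false, h0', Dir.vec, FarXY]
      omega
  · intro s hse hs k hk0 hk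
    rcases Nat.eq_zero_or_pos s with rfl | h0
    · simp only [posA, posD, if_true, Dir.vec]; omega
    · simp only [posA, posD, h0.ne', if_false, Dir.vec]
      omega

-- After the first tilt no tile of the bands can fall, so S affects only the front tile, which
-- stands above the lift.
set_option maxHeartbeats 2000000 in
theorem slotRun_A_S {K : ℕ} (hw : 0 < w) (hM : 2 * w ≤ M) (hK : K ≤ h * M) :
    SlotRun h w M .S False 1 K 0 (posA h M) (posA h M)
      fun _ => 0 := by
  have hM0 : 0 < M := by omega
  refine ⟨?_, ?_, ?_, ?_, ?_, ?_, ?_⟩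
  · intro _
    omega
  · intro s hse hs
    rcases Nat.eq_zero_or_pos s with rfl | h0
    · omega
    · simp only [posA, posD, h0.ne', if_false, Dir.vec]
      omega
  · intro s hse hs
    rcases Nat.eq_zero_or_pos s with rfl | h0
    · omega
    · simp only [posA, posD, h0.ne', if_false, Dir.vec]
      omega
  · intro s hse hs k hk0 hk
    rcases Nat.eq_zero_or_pos s with rfl | h0
    · omega
    · have h1 := slotCol_lt hM0 s
      have h2 := slotRow_lt hM0 h0 (show s < h * M + 1 by omega)
      simp only [posA, posD, h0.ne', if_false, Dir.vec]
      rw [isOpen_upper (by omega)]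
      omega
  · intro s hse hs
    rcases Nat.eq_zero_or_pos s with rfl | h0
    · omega
    · simp only [posA, posD, h0.ne', if_false, Dir.vec, IsBlocked]
      have h1 := slotCol_lt hM0 s
      have h2 := slotRow_lt hM0 h0 (show s < h * M + 1 by omega)
      rw [isOpen_upper (by omega)]
      omega
  · intro s s' hse hss hs k k' hk0 hk hk0' hk'
    have h0' : s' ≠ 0 := by omega
    rcases Nat.eq_zero_or_pos s with rfl | h0
    · omega
    · have h5 := slot_far hK hM0 h0 hss hs
      simp only [posA, posD, h0.ne', if_false, h0', Dir.vec, FarXY]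
      omega
  · intro s hse hs k hk0 hk
    rcases Nat.eq_zero_or_pos s with rfl | h0
    · omega
    · simp only [posA, posD, h0.ne', if_false, Dir.vec]
      omega

end

/-! ### Queue, column and rectangle as one family -/

section Families

variable {L : Type} {G : L → L → Bool} {ι : Type}

/-- Covers the degenerate mergers: the first tile of a column and the first column of the rectangle
meet nothing and merely change their index. -/
theorem pieces_unite_of_empty {F : ι → Set (Tile L)} {p q : ι} (hpq : p ≠ q) (h : F p = ∅) :
    pieces (unite F p q) = pieces F := by
  have hp : unite F p q p = F q := by simp [unite, h]
  have hq : unite F p q q = ∅ := by simp [unite, hpq.symm]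
  have hi : ∀ i, i ≠ p → i ≠ q → unite F p q i = F i := fun i h1 h2 => by simp [unite, h1, h2]
  ext P
  constructor
  · rintro ⟨hP, i, rfl⟩
    refine ⟨hP, ?_⟩
    by_cases h1 : i = p
    · subst h1; exact ⟨q, hp.symm⟩
    by_cases h2 : i = q
    · subst h2; rw [hq] at hP; exact absurd hP Set.not_nonempty_empty
    · exact ⟨i, (hi i h1 h2).symm⟩
  · rintro ⟨hP, i, rfl⟩
    refine ⟨hP, ?_⟩
    by_cases h1 : i = p
    · subst h1; rw [h] at hP; exact absurd hP Set.not_nonempty_empty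
    by_cases h2 : i = q
    · subst h2; exact ⟨p, hp⟩
    · exact ⟨i, hi i h1 h2⟩

/-- In `tilt_unite` the second piece is the one that arrives, and the union is stored under the
first. Here the arriving piece has to keep its name. -/
theorem pieces_unite_comm {F : ι → Set (Tile L)} {p q : ι} (hpq : p ≠ q) :
    pieces (unite F p q) = pieces (unite F q p) := by
  have key : ∀ p q : ι, p ≠ q → pieces (unite F p q) ⊆ pieces (unite F q p) := by
    rintro p q hpq _ ⟨hP, i, rfl⟩
    refine ⟨hP, ?_⟩
    by_cases h1 : i = p
    · subst h1
      exact ⟨q, by simp [unite, Set.union_comm]⟩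
    by_cases h2 : i = q
    · subst h2
      simp [unite, h1] at hP
    · exact ⟨i, by simp [unite, h1, h2]⟩
  exact (key p q hpq).antisymm (key q p hpq.symm)

/-- The pieces: the tiles in the track, the column under construction, and the rectangle of the
completed columns. -/
inductive Piece
  | tile (n : ℕ)
  | col
  | rect

/-- The tiles `n` with `t + e ≤ n < N` in the slots `n - t`, a column of `l` tiles with top end
`(cx, ct)`, and a rectangle of `c` columns of height `h` whose left end is at `rx`. -/
def fam (h N : ℕ) (lab : ℕ → L) (f : ℕ → ℕ → L) (P : ℕ → ℤ × ℤ) (t e c l : ℕ) (cx ct rx : ℤ) :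
    Piece → Set (Tile L)
  | .tile n => {τ | t + e ≤ n ∧ n < N ∧ τ = ⟨P (n - t), lab n⟩}
  | .col => {τ | ∃ q < l, τ = ⟨(cx, ct - q), f c q⟩}
  | .rect => {τ | ∃ i < c, ∃ q < h, τ = ⟨(rx + i, h + 1 - q), f i q⟩}

/-- The displacements of the pieces. -/
def disp (t : ℕ) (m : ℕ → ℕ) (mc mr : ℕ) : Piece → ℕ
  | .tile n => m (n - t)
  | .col => mc
  | .rect => mr

variable {h w M N t e c l T mc mr : ℕ} {lab : ℕ → L} {f : ℕ → ℕ → L} {P P' : ℕ → ℤ × ℤ}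
  {m : ℕ → ℕ} {cx ct rx cx' ct' rx' : ℤ} {d : Dir} {fr : Prop}

/-- The height of the rectangle is fixed in `fam`, as it only ever slides along the floor of the
pit; hence `hmr`. -/
theorem shift_fam (hS : SlotRun h w M d fr e (N - t) T P P' m)
    (hcx : cx' = cx + mc * d.vec.1) (hct : ct' = ct + mc * d.vec.2)
    (hrx : rx' = rx + mr * d.vec.1) (hmr : (mr : ℤ) * d.vec.2 = 0) :
    (fun i => Tile.shift (disp t m mc mr i • d.vec) '' fam h N lab f P t e c l cx ct rx i) =
      fam h N lab f P' t e c l cx' ct' rx' := by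
  funext i
  ext τ
  cases i with
  | tile n =>
    have key : t + e ≤ n → n < N →
        Tile.shift (m (n - t) • d.vec) ⟨P (n - t), lab n⟩ = (⟨P' (n - t), lab n⟩ : Tile L) := by
      intro h1 h2
      have a := hS.fst_eq (n - t) (by omega) (by omega)
      have b := hS.snd_eq (n - t) (by omega) (by omega)
      simp only [Tile.shift, Tile.mk.injEq, and_true]
      ext <;> simp [a, b]
    constructor
    · rintro ⟨_, ⟨h1, h2, rfl⟩, rfl⟩
      exact ⟨h1, h2, key h1 h2⟩
    · rintro ⟨h1, h2, rfl⟩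
      exact ⟨_, ⟨h1, h2, rfl⟩, key h1 h2⟩
  | col =>
    have key : ∀ q : ℕ, Tile.shift (mc • d.vec) ⟨(cx, ct - q), f c q⟩ =
        (⟨(cx', ct' - q), f c q⟩ : Tile L) := by
      intro q
      simp only [Tile.shift, Tile.mk.injEq, and_true]
      ext
      · simp [hcx]
      · simp [hct]; ring
    constructor
    · rintro ⟨_, ⟨q, hq, rfl⟩, rfl⟩
      exact ⟨q, hq, key q⟩
    · rintro ⟨q, hq, rfl⟩
      exact ⟨_, ⟨q, hq, rfl⟩, key q⟩
  | rect =>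
    have key : ∀ i q : ℕ, Tile.shift (mr • d.vec) ⟨(rx + i, h + 1 - q), f i q⟩ =
        (⟨(rx' + i, h + 1 - q), f i q⟩ : Tile L) := by
      intro i q
      simp only [Tile.shift, Tile.mk.injEq, and_true]
      ext
      · simp [hrx]; ring
      · simp [hmr]
    constructor
    · rintro ⟨_, ⟨i, hi, q, hq, rfl⟩, rfl⟩
      exact ⟨i, hi, q, hq, key i q⟩
    · rintro ⟨i, hi, q, hq, rfl⟩
      exact ⟨_, ⟨i, hi, q, hq, rfl⟩, key i q⟩

/-- The way of the column through the board. -/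
def ColPath (h w M : ℕ) (d : Dir) (l mc : ℕ) (cx ct : ℤ) : Prop :=
  ∀ y k : ℤ, ct - l < y → y ≤ ct → 0 ≤ k → k ≤ mc →
    IsOpen h w M (cx + k * d.vec.1) (y + k * d.vec.2) ∧ 6 ≤ cx + k * d.vec.1 ∧
      y + k * d.vec.2 ≤ 3 * h + 4

/-- The column is stopped by a blocked location. -/
def ColStop (h w M : ℕ) (d : Dir) (l mc : ℕ) (cx ct : ℤ) : Prop :=
  0 < l → ∃ y : ℤ, ct - l < y ∧ y ≤ ct ∧
    IsBlocked h w M (cx + (mc + 1) * d.vec.1) (y + (mc + 1) * d.vec.2)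

/-- The way of the rectangle through the board. -/
def RectPath (h w M : ℕ) (d : Dir) (c mr : ℕ) (rx : ℤ) : Prop :=
  ∀ x y k : ℤ, rx ≤ x → x < rx + c → 2 ≤ y → y ≤ h + 1 → 0 ≤ k → k ≤ mr →
    IsOpen h w M (x + k * d.vec.1) (y + k * d.vec.2) ∧ 6 ≤ x + k * d.vec.1 ∧
      y + k * d.vec.2 ≤ h + 1

/-- The rectangle is stopped by a blocked location. -/
def RectStop (h w M : ℕ) (d : Dir) (c mr : ℕ) (rx : ℤ) : Prop :=
  0 < c → ∃ x y : ℤ, rx ≤ x ∧ x < rx + c ∧ 2 ≤ y ∧ y ≤ h + 1 ∧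
    IsBlocked h w M (x + (mr + 1) * d.vec.1) (y + (mr + 1) * d.vec.2)

/-- The column and the rectangle do not meet. -/
def ColRectFar (h : ℕ) (d : Dir) (c l mc mr : ℕ) (cx ct rx : ℤ) : Prop :=
  ∀ y x' y' k k' : ℤ, ct - l < y → y ≤ ct → rx ≤ x' → x' < rx + c → 2 ≤ y' → y' ≤ h + 1 →
    0 ≤ k → k ≤ mc → 0 ≤ k' → k' ≤ mr →
    FarXY (cx + k * d.vec.1) (y + k * d.vec.2) (x' + k' * d.vec.1) (y' + k' * d.vec.2)

theorem far_add_iff {p q : ℤ × ℤ} {v : ℤ × ℤ} {n n' : ℕ} : Far (p + n • v) (q + n' • v) ↔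
    FarXY (p.1 + n * v.1) (p.2 + n * v.2) (q.1 + n' * v.1) (q.2 + n' * v.2) := by
  simp [Far, FarXY]

theorem FarXY.symm {x y x' y' : ℤ} (h : FarXY x y x' y') : FarXY x' y' x y := by
  unfold FarXY at *; omega

/-- The queue stays in `y ≥ 3 * h + 6` or `x ≤ 4`, column and rectangle in `x ≥ 6`, `y ≤ 3 * h + 4`.
There remain the front tile in the feed against the column, and the column against the rectangle.
`Qt` and `Qr` allow a pair that is meant to merge to be left out. -/
theorem fam_far (hS : SlotRun h w M d fr e (N - t) T P P' m)
    (hcp : ColPath h w M d l mc cx ct) (hrp : RectPath h w M d c mr rx)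
    (Qt : ℕ → Prop) (Qr : Prop)
    (hfr : ∀ n, Qt n → n = t → fr → e = 0 → ∀ y k : ℤ, ct - l < y → y ≤ ct → 0 ≤ k → k ≤ mc →
      2 * h + 6 ≤ y + k * d.vec.2)
    (hcr : Qr → ColRectFar h d c l mc mr cx ct rx) (i j : Piece) (hij : i ≠ j)
    (hQt : ∀ n, (i = .tile n ∧ j = .col) ∨ (i = .col ∧ j = .tile n) → Qt n)
    (hQr : (i = .col ∧ j = .rect) ∨ (i = .rect ∧ j = .col) → Qr)
    (σ : Tile L) (hσ : σ ∈ fam h N lab f P t e c l cx ct rx i)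
    (τ : Tile L) (hτ : τ ∈ fam h N lab f P t e c l cx ct rx j)
    (n : ℕ) (hn : n ≤ disp t m mc mr i) (n' : ℕ) (hn' : n' ≤ disp t m mc mr j) :
    Far (σ.pos + n • d.vec) (τ.pos + n' • d.vec) := by
  have tc : ∀ a, Qt a → ∀ σ ∈ fam h N lab f P t e c l cx ct rx (.tile a),
      ∀ τ ∈ fam h N lab f P t e c l cx ct rx .col, ∀ n ≤ m (a - t), ∀ n' ≤ mc,
      Far (σ.pos + n • d.vec) (τ.pos + n' • d.vec) := by
    rintro a hQ _ ⟨h1, h2, rfl⟩ _ ⟨q, hq, rfl⟩ n hn n' hn'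
    rw [far_add_iff]
    have h3 := hS.clear (a - t) (by omega) (by omega) n (by omega) (by omega)
    have h4 := hcp (ct - q) n' (by omega) (by omega) (by omega) (by omega)
    have h5 : a = t → fr → e = 0 → 2 * (h : ℤ) + 6 ≤ ct - q + n' * d.vec.2 :=
      fun e1 e2 e3 => hfr a hQ e1 e2 e3 _ _ (by omega) (by omega) (by omega) (by omega)
    dsimp only at *
    unfold FarXY
    rcases h3 with h3 | h3 | ⟨h3, h6, h7, h8⟩
    · omega
    · omega
    · have := h5 (by omega) h6 (by omega)
      omega
  have tr : ∀ a, ∀ σ ∈ fam h N lab f P t e c l cx ct rx (.tile a),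
      ∀ τ ∈ fam h N lab f P t e c l cx ct rx .rect, ∀ n ≤ m (a - t), ∀ n' ≤ mr,
      Far (σ.pos + n • d.vec) (τ.pos + n' • d.vec) := by
    rintro a _ ⟨h1, h2, rfl⟩ _ ⟨i, hi, q, hq, rfl⟩ n hn n' hn'
    rw [far_add_iff]
    have h3 := hS.clear (a - t) (by omega) (by omega) n (by omega) (by omega)
    have h4 := hrp (rx + i) (h + 1 - q) n' (by omega) (by omega) (by omega) (by omega) (by omega)
      (by omega)
    dsimp only at *
    unfold FarXY
    omega
  have cr : Qr → ∀ σ ∈ fam h N lab f P t e c l cx ct rx .col,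
      ∀ τ ∈ fam h N lab f P t e c l cx ct rx .rect, ∀ n ≤ mc, ∀ n' ≤ mr,
      Far (σ.pos + n • d.vec) (τ.pos + n' • d.vec) := by
    rintro hQ _ ⟨q', hq', rfl⟩ _ ⟨i, hi, q, hq, rfl⟩ n hn n' hn'
    rw [far_add_iff]
    exact hcr hQ (ct - q') (rx + i) (h + 1 - q) n n' (by omega) (by omega) (by omega) (by omega)
      (by omega) (by omega) (by omega) (by omega) (by omega) (by omega)
  cases i with
  | tile a =>
    cases j with
    | tile b =>
      obtain ⟨h1, h2, rfl⟩ := hσ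
      obtain ⟨h3, h4, rfl⟩ := hτ
      rw [far_add_iff]
      simp only [disp] at hn hn'
      have hab : a ≠ b := fun h => hij (by rw [h])
      rcases lt_or_gt_of_ne hab with hlt | hlt
      · exact hS.far (a - t) (b - t) (by omega) (by omega) (by omega) n n' (by omega) (by omega)
          (by omega) (by omega)
      · exact (hS.far (b - t) (a - t) (by omega) (by omega) (by omega) n' n (by omega) (by omega)
          (by omega) (by omega)).symm
    | col => exact tc a (hQt a (Or.inl ⟨rfl, rfl⟩)) σ hσ τ hτ n hn n' hn'
    | rect => exact tr a σ hσ τ hτ n hn n' hn'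
  | col =>
    cases j with
    | tile b => exact (tc b (hQt b (Or.inr ⟨rfl, rfl⟩)) τ hτ σ hσ n' hn' n hn).symm
    | col => exact absurd rfl hij
    | rect => exact cr (hQr (Or.inl ⟨rfl, rfl⟩)) σ hσ τ hτ n hn n' hn'
  | rect =>
    cases j with
    | tile b => exact (tr b τ hτ σ hσ n' hn' n hn).symm
    | col => exact (cr (hQr (Or.inr ⟨rfl, rfl⟩)) τ hτ σ hσ n' hn' n hn).symm
    | rect => exact absurd rfl hij

theorem fam_path (hw : 0 < w) (hM : 2 * w ≤ M) (hS : SlotRun h w M d fr e (N - t) T P P' m)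
    (hcp : ColPath h w M d l mc cx ct) (hrp : RectPath h w M d c mr rx) (i : Piece)
    (σ : Tile L) (hσ : σ ∈ fam h N lab f P t e c l cx ct rx i) (n : ℕ)
    (hn : n ≤ disp t m mc mr i) : σ.pos + n • d.vec ∈ (track h w M).openLocs := by
  rw [mem_openLocs_track hw hM]
  cases i with
  | tile a =>
    obtain ⟨h1, h2, rfl⟩ := hσ
    simp only [disp] at hn
    simpa using hS.path (a - t) (by omega) (by omega) n (by omega) (by omega)
  | col =>
    obtain ⟨q, hq, rfl⟩ := hσ
    simp only [disp] at hn
    simpa using (hcp (ct - q) n (by omega) (by omega) (by omega) (by omega)).1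
  | rect =>
    obtain ⟨i, hi, q, hq, rfl⟩ := hσ
    simp only [disp] at hn
    simpa using (hrp (rx + i) (h + 1 - q) n (by omega) (by omega) (by omega) (by omega) (by omega)
      (by omega)).1

theorem tile_halt (hS : SlotRun h w M d fr e (N - t) T P P' m) (n : ℕ)
    (hne : (fam h N lab f P t e c l cx ct rx (.tile n)).Nonempty) :
    ∃ τ ∈ fam h N lab f P t e c l cx ct rx (.tile n),
      τ.pos + (disp t m mc mr (.tile n) + 1) • d.vec ∈ (track h w M).blocked := by
  obtain ⟨_, h1, h2, rfl⟩ := hne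
  refine ⟨_, ⟨h1, h2, rfl⟩, ?_⟩
  rw [mem_blocked_track]
  simpa [disp, IsBlocked] using hS.halt (n - t) (by omega) (by omega)

theorem col_halt (h0 : ColStop h w M d l mc cx ct)
    (hne : (fam h N lab f P t e c l cx ct rx .col).Nonempty) :
    ∃ τ ∈ fam h N lab f P t e c l cx ct rx .col,
      τ.pos + (disp t m mc mr .col + 1) • d.vec ∈ (track h w M).blocked := by
  obtain ⟨_, q, hq, rfl⟩ := hne
  obtain ⟨y, h1, h2, hb⟩ := h0 (by omega)
  refine ⟨_, ⟨(ct - y).toNat, by omega, rfl⟩, ?_⟩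
  rw [mem_blocked_track]
  have : ct - ((ct - y).toNat : ℤ) = y := by omega
  simp only [Prod.fst_add, Prod.snd_add, Prod.smul_fst, Prod.smul_snd, this]
  simpa [disp, IsBlocked] using hb

theorem rect_halt (h0 : RectStop h w M d c mr rx)
    (hne : (fam h N lab f P t e c l cx ct rx .rect).Nonempty) :
    ∃ τ ∈ fam h N lab f P t e c l cx ct rx .rect,
      τ.pos + (disp t m mc mr .rect + 1) • d.vec ∈ (track h w M).blocked := by
  obtain ⟨_, i, hi, q, hq, rfl⟩ := hne
  obtain ⟨x, y, h1, h2, h3, h4, hb⟩ := h0 (by omega)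
  refine ⟨_, ⟨(x - rx).toNat, by omega, (h + 1 - y).toNat, by omega, rfl⟩, ?_⟩
  rw [mem_blocked_track]
  have e1 : (h : ℤ) + 1 - ((h + 1 - y).toNat : ℤ) = y := by omega
  have e2 : rx + ((x - rx).toNat : ℤ) = x := by omega
  simp only [Prod.fst_add, Prod.snd_add, Prod.smul_fst, Prod.smul_snd, e1, e2]
  simpa [disp, IsBlocked] using hb

/-- A tilt in which no two pieces meet. -/
theorem slide_fam {C : Config (track h w M) G} (hw : 0 < w) (hM : 2 * w ≤ M)
    (hC : C.polys = pieces (fam h N lab f P t e c l cx ct rx))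
    (hS : SlotRun h w M d fr e (N - t) T P P' m)
    (hcp : ColPath h w M d l mc cx ct) (hcs : ColStop h w M d l mc cx ct)
    (hrp : RectPath h w M d c mr rx) (hrs : RectStop h w M d c mr rx)
    (hcr : ColRectFar h d c l mc mr cx ct rx)
    (hfr : fr → e = 0 → ∀ y k : ℤ, ct - l < y → y ≤ ct → 0 ≤ k → k ≤ mc →
      2 * h + 6 ≤ y + k * d.vec.2)
    (hcx : cx' = cx + mc * d.vec.1) (hct : ct' = ct + mc * d.vec.2)
    (hrx : rx' = rx + mr * d.vec.1) (hmr : (mr : ℤ) * d.vec.2 = 0) :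
    ∃ C' : Config (track h w M) G, Tilt d C C' ∧
      C'.polys = pieces (fam h N lab f P' t e c l cx' ct' rx') := by
  rw [← shift_fam (lab := lab) (f := f) (c := c) (l := l) hS hcx hct hrx hmr]
  refine tilt_slide (T := T + mc + mr) hC ?_ ⟨?_, ?_⟩ ?_
  · intro i
    cases i with
    | tile n => have := hS.le (n - t); simp only [disp]; omega
    | col => simp only [disp]; omega
    | rect => simp only [disp]; omega
  · exact fun i σ hσ n _ hn => fam_path hw hM hS hcp hrp i σ hσ n hn
  · intro i _ hne
    cases i with
    | tile n => exact tile_halt hS n hne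
    | col => exact col_halt hcs hne
    | rect => exact rect_halt hrs hne
  · rintro n _ i j hij _ ⟨σ, hσ, rfl⟩ _ ⟨τ, hτ, rfl⟩
    exact fam_far hS hcp hrp (fun _ => True) True (fun _ _ _ => hfr) (fun _ => hcr) i j hij
      (fun _ _ => trivial) (fun _ => trivial) σ hσ τ hτ _ (min_le_right _ _) _ (min_le_right _ _)

end Families

/-! ### Chambers of the column and the rectangle -/

theorem isOpen_pit {h w M : ℕ} {x y : ℤ} (h1 : 6 ≤ x) (h2 : x ≤ w + 7) (h3 : 2 ≤ y)
    (h4 : y ≤ h + 1) : IsOpen h w M x y :=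
  Or.inr (Or.inl ⟨h1, h2, h3, h4⟩)

theorem isOpen_well {h w M : ℕ} {x y : ℤ} (h1 : w + 6 ≤ x) (h2 : x ≤ w + 7) (h3 : h + 3 ≤ y)
    (h4 : y ≤ 2 * h + 2) : IsOpen h w M x y :=
  Or.inr (Or.inr (Or.inr (Or.inl ⟨h1, h2, h3, h4⟩)))

theorem isOpen_tower {h w M : ℕ} {x y : ℤ} (h1 : w + 7 ≤ x) (h2 : x ≤ w + 8)
    (h3 : 2 * h + 3 ≤ y) (h4 : y ≤ 3 * h + 4) : IsOpen h w M x y :=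
  Or.inr (Or.inr (Or.inr (Or.inr (Or.inl ⟨h1, h2, h3, h4⟩))))

/-- Well and tower share the vertical `x = w + 7`, along which the column rises and falls in each
cycle. -/
theorem isOpen_chimney {h w M : ℕ} {x y : ℤ} (h1 : w + 7 ≤ x) (h2 : x ≤ w + 7)
    (h3 : h + 3 ≤ y) (h4 : y ≤ 3 * h + 4) : IsOpen h w M x y := by
  by_cases hy : y ≤ 2 * h + 2
  · exact isOpen_well (by omega) h2 h3 hy
  · exact isOpen_tower h1 (by omega) (by omega) h4

/-- The vertical `x = w + 6` is the only connection between well and pit. The column normally rests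
beside it, at `x = w + 7`. -/
theorem isOpen_shaft {h w M : ℕ} {x y : ℤ} (h1 : w + 6 ≤ x) (h2 : x ≤ w + 6)
    (h3 : 2 ≤ y) (h4 : y ≤ 2 * h + 2) : IsOpen h w M x y := by
  rcases lt_trichotomy y (h + 2) with hy | hy | hy
  · exact isOpen_pit (by omega) (by omega) h3 (by omega)
  · exact Or.inr (Or.inr (Or.inl ⟨by omega, hy⟩))
  · exact isOpen_well h1 (by omega) (by omega) h4

/-! ### The effect of single tilts on the whole machine -/

section Tilts

variable {L : Type} {G : L → L → Bool} {h w M N t e c l : ℕ} {lab : ℕ → L} {f : ℕ → ℕ → L}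

/-- The configuration after the first tilt of a cycle. -/
theorem tilt_east_first {C : Config (track h w M) G} (hh : 0 < h) (hw : 0 < w) (hM : 2 * w ≤ M)
    (hN : N ≤ h * M) (hl : l ≤ h) (hc : c ≤ w)
    (hC : C.polys = pieces (fam h N lab f (posD h M) t e c l (w + 7) (h + 2 + l) 6)) :
    ∃ C' : Config (track h w M) G, Tilt .E C C' ∧ C'.polys =
      pieces (fam h N lab f (posA h M) t e c l (w + 7) (h + 2 + l) (w + 8 - c)) := by
  refine slide_fam (mc := 0) (mr := w + 2 - c) hw hM hC (slotRun_DA hw hM (by omega))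
    ?_ ?_ ?_ ?_ ?_ ?_ ?_ ?_ ?_ ?_
  · intro y k _ _ _ _
    refine ⟨isOpen_well ?_ ?_ ?_ ?_, ?_, ?_⟩ <;> simp only [Dir.vec] <;> omega
  · intro _
    refine ⟨h + 3, by omega, by omega, ?_⟩
    simp only [Dir.vec, IsBlocked, IsOpen]; omega
  · intro x y k _ _ _ _ _ _
    refine ⟨isOpen_pit ?_ ?_ ?_ ?_, ?_, ?_⟩ <;> simp only [Dir.vec] <;> omega
  · intro _
    refine ⟨6 + c - 1, 2, by omega, by omega, by omega, by omega, ?_⟩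
    simp only [Dir.vec, IsBlocked, IsOpen]; omega
  · intro y x' y' k k' _ _ _ _ _ _ _ _ _ _
    simp only [Dir.vec, FarXY]; omega
  · exact False.elim
  all_goals simp [Dir.vec] <;> omega

/-- The configuration after the second tilt of a cycle. -/
theorem tilt_north {C : Config (track h w M) G} (hh : 0 < h) (hw : 0 < w) (hM : 2 * w ≤ M)
    (hN : N ≤ h * M) (hl : l ≤ h) (hc : c ≤ w)
    (hC : C.polys =
      pieces (fam h N lab f (posA h M) t e c l (w + 7) (h + 2 + l) (w + 8 - c))) :
    ∃ C' : Config (track h w M) G, Tilt .N C C' ∧ C'.polys =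
      pieces (fam h N lab f (posB h M) t e c l (w + 7) (3 * h + 4) (w + 8 - c)) := by
  -- The top of the column rises from `h + 2 + l` to the ceiling `3 * h + 4`. The rectangle stands
  -- at the eastern end of the pit, held by the blocked point above its upper right corner.
  refine slide_fam (mc := 2 * h + 2 - l) (mr := 0) hw hM hC (slotRun_AB hw hM (by omega))
    ?_ ?_ ?_ ?_ ?_ ?_ ?_ ?_ ?_ ?_
  · intro y k _ _ _ _
    refine ⟨isOpen_chimney ?_ ?_ ?_ ?_, ?_, ?_⟩ <;> simp only [Dir.vec] <;> omega
  · intro _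
    refine ⟨h + 2 + l, by omega, by omega, ?_⟩
    simp only [Dir.vec, IsBlocked, IsOpen]; omega
  · intro x y k _ _ _ _ _ _
    refine ⟨isOpen_pit ?_ ?_ ?_ ?_, ?_, ?_⟩ <;> simp only [Dir.vec] <;> omega
  · intro _
    refine ⟨w + 7, h + 1, by omega, by omega, by omega, by omega, ?_⟩
    simp only [Dir.vec, IsBlocked, IsOpen]; omega
  · intro y x' y' k k' _ _ _ _ _ _ _ _ _ _
    simp only [Dir.vec, FarXY]; omega
  · exact False.elim
  all_goals simp [Dir.vec] <;> omega

/-- The configuration after the third tilt of a cycle. -/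
theorem tilt_east_second {C : Config (track h w M) G} (hh : 0 < h) (hw : 0 < w) (hM : 2 * w ≤ M)
    (hN : N ≤ h * M) (hl : l ≤ h) (hle : e = 0 → l < h) (hc : c ≤ w)
    (hC : C.polys =
      pieces (fam h N lab f (posB h M) t e c l (w + 7) (3 * h + 4) (w + 8 - c))) :
    ∃ C' : Config (track h w M) G, Tilt .E C C' ∧ C'.polys =
      pieces (fam h N lab f (posC h w M) t e c l (w + 8) (3 * h + 4) (w + 8 - c)) := by
  refine slide_fam (mc := 1) (mr := 0) hw hM hC (slotRun_BC hw hM (by omega))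
    ?_ ?_ ?_ ?_ ?_ ?_ ?_ ?_ ?_ ?_
  · intro y k _ _ _ _
    refine ⟨isOpen_tower ?_ ?_ ?_ ?_, ?_, ?_⟩ <;> simp only [Dir.vec] <;> omega
  · intro _
    refine ⟨3 * h + 4, by omega, by omega, ?_⟩
    simp only [Dir.vec, IsBlocked, IsOpen]; omega
  · intro x y k _ _ _ _ _ _
    refine ⟨isOpen_pit ?_ ?_ ?_ ?_, ?_, ?_⟩ <;> simp only [Dir.vec] <;> omega
  · intro _
    refine ⟨w + 7, 2, by omega, by omega, by omega, by omega, ?_⟩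
    simp only [Dir.vec, IsBlocked, IsOpen]; omega
  · intro y x' y' k k' _ _ _ _ _ _ _ _ _ _
    simp only [Dir.vec, FarXY]; omega
  · intro _ he y k _ _ _ _
    -- A column of fewer than `h` tiles hanging from the ceiling ends in row `2 * h + 6` or higher,
    -- clear of the front tile in row `2 * h + 4`. A full one would end in row `2 * h + 5` and be
    -- glued too early.
    have := hle he
    simp only [Dir.vec]; omega
  all_goals simp [Dir.vec] <;> omega

/-- The configuration after the fourth tilt of a cycle without a front tile. -/
theorem tilt_south_first {C : Config (track h w M) G} (hh : 0 < h) (hw : 0 < w) (hM : 2 * w ≤ M)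
    (hN : N ≤ h * M) (hl : l ≤ h) (hc : c ≤ w)
    (hC : C.polys =
      pieces (fam h N lab f (posC h w M) t 1 c l (w + 8) (3 * h + 4) (w + 8 - c))) :
    ∃ C' : Config (track h w M) G, Tilt .S C C' ∧ C'.polys =
      pieces (fam h N lab f (posE h w M) t 1 c l (w + 8) (2 * h + 2 + l) (w + 8 - c)) := by
  refine slide_fam (mc := h + 2 - l) (mr := 0) hw hM hC (slotRun_CE hw hM (by omega))
    ?_ ?_ ?_ ?_ ?_ ?_ ?_ ?_ ?_ ?_
  · intro y k _ _ _ _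
    refine ⟨isOpen_tower ?_ ?_ ?_ ?_, ?_, ?_⟩ <;> simp only [Dir.vec] <;> omega
  · intro _
    refine ⟨3 * h + 5 - l, by omega, by omega, ?_⟩
    simp only [Dir.vec, IsBlocked, IsOpen]; omega
  · intro x y k _ _ _ _ _ _
    refine ⟨isOpen_pit ?_ ?_ ?_ ?_, ?_, ?_⟩ <;> simp only [Dir.vec] <;> omega
  · intro _
    refine ⟨w + 7, 2, by omega, by omega, by omega, by omega, ?_⟩
    simp only [Dir.vec, IsBlocked, IsOpen]; omega
  · intro y x' y' k k' _ _ _ _ _ _ _ _ _ _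
    simp only [Dir.vec, FarXY]; omega
  · intro _ he; omega
  all_goals simp [Dir.vec] <;> omega

/-- The configuration after the fourth tilt of a cycle with a front tile: the column lands on the
front tile. -/
theorem tilt_south_keep {C : Config (track h w M) G} (hG : ∀ a b, G a b = true) (hh : 0 < h)
    (hw : 0 < w) (hM : 2 * w ≤ M) (hN : N ≤ h * M) (ht : t < N) (hl : l < h) (hc : c ≤ w)
    (hlab : lab t = f c l)
    (hC : C.polys =
      pieces (fam h N lab f (posC h w M) t 0 c l (w + 8) (3 * h + 4) (w + 8 - c))) :
    ∃ C' : Config (track h w M) G, Tilt .S C C' ∧ C'.polys =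
      pieces (fam h N lab f (posE h w M) t 1 c (l + 1) (w + 8) (2 * h + 3 + l) (w + 8 - c)) := by
  have hS := slotRun_CE (h := h) (w := w) (M := M) (e := 0) (K := N - t) hw hM (by omega)
  -- One step less than without a front tile: the column stops in row `2 * h + 4`, on top of the
  -- tile in row `2 * h + 3`.
  have hcp : ColPath h w M .S l (h + 1 - l) (w + 8) (3 * h + 4) := by
    intro y k _ _ _ _
    refine ⟨isOpen_tower ?_ ?_ ?_ ?_, ?_, ?_⟩ <;> simp only [Dir.vec] <;> omega
  have hrp : RectPath h w M .S c 0 (w + 8 - c) := by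
    intro x y k _ _ _ _ _ _
    refine ⟨isOpen_pit ?_ ?_ ?_ ?_, ?_, ?_⟩ <;> simp only [Dir.vec] <;> omega
  have hrs : RectStop h w M .S c 0 (w + 8 - c) := by
    intro _
    refine ⟨w + 7, 2, by omega, by omega, by omega, by omega, ?_⟩
    simp only [Dir.vec, IsBlocked, IsOpen]; omega
  have hcr : ColRectFar h .S c l (h + 1 - l) 0 (w + 8) (3 * h + 4) (w + 8 - c) := by
    intro y x' y' k k' _ _ _ _ _ _ _ _ _ _
    simp only [Dir.vec, FarXY]; omega
  have hne : Piece.tile t ≠ Piece.col := by simp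
  have hres : unite (fam h N lab f (posE h w M) t 0 c l (w + 8) (2 * h + 3 + l) (w + 8 - c))
      .col (.tile t) =
      fam h N lab f (posE h w M) t 1 c (l + 1) (w + 8) (2 * h + 3 + l) (w + 8 - c) := by
    funext i
    cases i with
    | tile n =>
      by_cases hn : n = t
      · subst hn
        ext τ
        simp [unite, fam]
      · ext τ
        simp only [unite, hn, fam, Piece.tile.injEq, reduceCtorEq, if_false, Set.mem_ofPred_eq]
        constructor
        · rintro ⟨h1, h2, h3⟩; exact ⟨by omega, h2, h3⟩
        · rintro ⟨h1, h2, h3⟩; exact ⟨by omega, h2, h3⟩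
    | col =>
      ext τ
      simp only [unite, if_true, fam, Set.mem_union, Set.mem_ofPred_eq, Nat.sub_self, posE, hlab]
      constructor
      · rintro (⟨q, hq, rfl⟩ | ⟨-, -, rfl⟩)
        · exact ⟨q, by omega, rfl⟩
        · exact ⟨l, by omega, by simp⟩
      · rintro ⟨q, hq, rfl⟩
        rcases Nat.lt_succ_iff_lt_or_eq.1 hq with hq | rfl
        · exact Or.inl ⟨q, hq, rfl⟩
        · exact Or.inr ⟨by omega, ht, by simp⟩
    | rect => simp [unite, fam]
  have hshift := shift_fam (lab := lab) (f := f) (c := c) (l := l) (mc := h + 1 - l) (mr := 0)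
    (cx := w + 8) (ct := 3 * h + 4) (rx := w + 8 - c) (cx' := w + 8) (ct' := 2 * h + 3 + l)
    (rx' := w + 8 - c) hS (by simp [Dir.vec]) (by simp [Dir.vec]; omega) (by simp [Dir.vec])
    (by simp)
  -- With no column yet, the front tile just sinks and is renamed as a column of length one.
  rcases Nat.eq_zero_or_pos l with rfl | h0
  · obtain ⟨C', hT, hp⟩ := slide_fam (cx' := w + 8) (ct' := 2 * h + 3 + (0 : ℕ))
      (rx' := w + 8 - c) hw hM hC hS hcp (fun h => absurd h (by omega)) hrp hrs hcr
      (fun _ _ y k _ _ _ _ => by omega)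
      (by simp [Dir.vec]) (by simp [Dir.vec]; omega) (by simp [Dir.vec]) (by simp)
    refine ⟨C', hT, ?_⟩
    rw [hp, ← hres, pieces_unite_of_empty hne.symm]
    ext τ
    simp [fam]
  · rw [← hres, ← pieces_unite_comm hne, ← hshift]
    -- As `l < h`, contact comes at time 2 or later, when the front tile has already completed its
    -- single step. `T'` is a crude bound for all displacements.
    refine tilt_unite (T := h + 1 - l) (T' := h + 6) hne hC ?_ ?_ ?_ ?_ rfl ?_ ?_ ?_ ?_ ?_ ?_
    · intro i
      cases i with
      | tile n => have := hS.le (n - t); simp only [disp] at *; omega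
      | col => simp only [disp]; omega
      | rect => simp only [disp]; omega
    · omega
    · omega
    · simp only [disp, Nat.sub_self, if_true]; omega
    · exact ⟨_, 0, h0, rfl⟩
    · exact fun i σ hσ n _ hn => fam_path hw hM hS hcp hrp i σ hσ n hn
    · intro i hi hne
      cases i with
      | tile n => exact tile_halt hS n hne
      | col => exact absurd rfl hi
      | rect => exact rect_halt hrs hne
    · intro i j hij h1 h2 σ hσ τ hτ n hn n' hn'
      refine fam_far hS hcp hrp (fun n => n ≠ t) True ?_ (fun _ => hcr) i j hij ?_
        (fun _ => trivial) σ hσ τ hτ n hn n' hn'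
      · exact fun n hn hn' => absurd hn' hn
      · rintro n (⟨rfl, rfl⟩ | ⟨rfl, rfl⟩) rfl
        · exact h1 ⟨rfl, rfl⟩
        · exact h2 ⟨rfl, rfl⟩
    · rintro _ ⟨-, -, rfl⟩ _ ⟨q, hq, rfl⟩ n hn
      rw [far_add_iff]
      simp only [disp, Nat.sub_self, if_true, posC, Dir.vec, FarXY]
      omega
    · refine ⟨_, ⟨_, ⟨by omega, ht, rfl⟩, rfl⟩, _, ⟨_, ⟨l - 1, by omega, rfl⟩, rfl⟩, ?_, hG _ _,
        hG _ _⟩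
      have e2 : 2 * (h : ℤ) + 4 + -1 - (3 * h + 4 - ((l - 1 : ℕ) : ℤ) + -((h + 1 - l : ℕ) : ℤ)) =
        -1 := by omega
      simp [Tile.shift, Adjacent, disp, posC, Dir.vec, e2]

/-- The configuration after the fifth tilt of a cycle. -/
theorem tilt_west {C : Config (track h w M) G} (hh : 0 < h) (hw : 0 < w) (hM : 2 * w ≤ M)
    (hN : N ≤ h * M) (hl : l ≤ h) (hc : c ≤ w)
    (hC : C.polys =
      pieces (fam h N lab f (posE h w M) t 1 c l (w + 8) (2 * h + 2 + l) (w + 8 - c))) :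
    ∃ C' : Config (track h w M) G, Tilt .W C C' ∧ C'.polys =
      pieces (fam h N lab f (posF h M) t 1 c l (w + 7) (2 * h + 2 + l) 6) := by
  refine slide_fam (mc := 1) (mr := w + 2 - c) hw hM hC (slotRun_EF hw hM (by omega))
    ?_ ?_ ?_ ?_ ?_ ?_ ?_ ?_ ?_ ?_
  · intro y k _ _ _ _
    refine ⟨isOpen_tower ?_ ?_ ?_ ?_, ?_, ?_⟩ <;> simp only [Dir.vec] <;> omega
  · intro _
    -- The lowest tile must be the one that is stopped: the next row, `2 * h + 4`, is the feed and
    -- open to the west.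
    refine ⟨2 * h + 3, by omega, by omega, ?_⟩
    simp only [Dir.vec, IsBlocked, IsOpen]; omega
  · intro x y k _ _ _ _ _ _
    refine ⟨isOpen_pit ?_ ?_ ?_ ?_, ?_, ?_⟩ <;> simp only [Dir.vec] <;> omega
  · intro _
    refine ⟨w + 8 - c, 2, by omega, by omega, by omega, by omega, ?_⟩
    simp only [Dir.vec, IsBlocked, IsOpen]; omega
  · intro y x' y' k k' _ _ _ _ _ _ _ _ _ _
    simp only [Dir.vec, FarXY]; omega
  · exact False.elim
  all_goals simp [Dir.vec] <;> omega

/-- The configuration after a cycle of tilts. -/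
theorem tilt_south_last {C : Config (track h w M) G} (hh : 0 < h) (hw : 0 < w) (hM : 2 * w ≤ M)
    (hN : N ≤ h * M) (hl : l ≤ h) (hc : c ≤ w)
    (hC : C.polys =
      pieces (fam h N lab f (posF h M) t 1 c l (w + 7) (2 * h + 2 + l) 6)) :
    ∃ C' : Config (track h w M) G, Tilt .S C C' ∧ C'.polys =
      pieces (fam h N lab f (posD h M) (t + 1) 0 c l (w + 7) (h + 2 + l) 6) := by
  -- Renumbering: without its front slot, the queue counted from `t` is the queue counted from `t +
  -- 1`, each slot number lowered by one.
  have hP : fam h N lab f (posD h M) (t + 1) 0 c l (w + 7) (h + 2 + l) 6 =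
      fam h N lab f (fun s => posD h M (s - 1)) t 1 c l (w + 7) (h + 2 + l) 6 := by
    funext i
    cases i <;> rfl
  rw [hP]
  refine slide_fam (mc := h) (mr := 0) hw hM hC (slotRun_FD hw hM (by omega))
    ?_ ?_ ?_ ?_ ?_ ?_ ?_ ?_ ?_ ?_
  · intro y k _ _ _ _
    refine ⟨isOpen_chimney ?_ ?_ ?_ ?_, ?_, ?_⟩ <;> simp only [Dir.vec] <;> omega
  · intro _
    refine ⟨2 * h + 3, by omega, by omega, ?_⟩
    simp only [Dir.vec, IsBlocked, IsOpen]; omega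
  · intro x y k _ _ _ _ _ _
    refine ⟨isOpen_pit ?_ ?_ ?_ ?_, ?_, ?_⟩ <;> simp only [Dir.vec] <;> omega
  · intro _
    refine ⟨6, 2, by omega, by omega, by omega, by omega, ?_⟩
    simp only [Dir.vec, IsBlocked, IsOpen]; omega
  · intro y x' y' k k' _ _ _ _ _ _ _ _ _ _
    simp only [Dir.vec, FarXY]; omega
  · exact False.elim
  all_goals simp [Dir.vec] <;> omega

/-- The front tile is discarded. -/
theorem tilt_discard {C : Config (track h w M) G} (hh : 0 < h) (hw : 0 < w) (hM : 2 * w ≤ M)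
    (hN : N ≤ h * M) (ht : t < N) (hl : l ≤ h) (hc : c ≤ w)
    (hC : C.polys =
      pieces (fam h N lab f (posA h M) t 0 c l (w + 7) (h + 2 + l) (w + 8 - c))) :
    ∃ C' : Config (track h w M) G, Tilt .S C C' ∧ C'.polys =
      pieces (fam h N lab f (posA h M) t 1 c l (w + 7) (h + 2 + l) (w + 8 - c)) := by
  have hS := slotRun_A_S (h := h) (w := w) (M := M) (K := N - t) hw hM (by omega)
  have hcp : ColPath h w M .S l 0 (w + 7) (h + 2 + l) := by
    intro y k _ _ _ _
    refine ⟨isOpen_well ?_ ?_ ?_ ?_, ?_, ?_⟩ <;> simp only [Dir.vec] <;> omega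
  have hcs : ColStop h w M .S l 0 (w + 7) (h + 2 + l) := by
    intro _
    refine ⟨h + 3, by omega, by omega, ?_⟩
    simp only [Dir.vec, IsBlocked, IsOpen]; omega
  have hrp : RectPath h w M .S c 0 (w + 8 - c) := by
    intro x y k _ _ _ _ _ _
    refine ⟨isOpen_pit ?_ ?_ ?_ ?_, ?_, ?_⟩ <;> simp only [Dir.vec] <;> omega
  have hrs : RectStop h w M .S c 0 (w + 8 - c) := by
    intro _
    refine ⟨w + 7, 2, by omega, by omega, by omega, by omega, ?_⟩
    simp only [Dir.vec, IsBlocked, IsOpen]; omega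
  have hcr : ColRectFar h .S c l 0 0 (w + 7) (h + 2 + l) (w + 8 - c) := by
    intro y x' y' k k' _ _ _ _ _ _ _ _ _ _
    simp only [Dir.vec, FarXY]; omega
  have hi : ∀ i, i ≠ .tile t →
      fam h N lab f (posA h M) t 1 c l (w + 7) (h + 2 + l) (w + 8 - c) i =
      fam h N lab f (posA h M) t 0 c l (w + 7) (h + 2 + l) (w + 8 - c) i := by
    intro i hi
    cases i with
    | tile n =>
      have hn : n ≠ t := fun h => hi (by rw [h])
      ext τ
      simp only [fam, Set.mem_ofPred_eq]
      constructor
      · rintro ⟨h1, h2, h3⟩; exact ⟨by omega, h2, h3⟩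
      · rintro ⟨h1, h2, h3⟩; exact ⟨by omega, h2, h3⟩
    | col => rfl
    | rect => rfl
  have h0 : fam h N lab f (posA h M) t 1 c l (w + 7) (h + 2 + l) (w + 8 - c) (.tile t) = ∅ := by
    ext τ; simp [fam]
  -- The lift leads from row `2 * h + 2` down to row 1, the edge of the board.
  obtain ⟨C', hT, hp⟩ := tilt_exit (d := .S) (q := .tile t) (T := 2 * h + 1) hC
    (by
      rintro i hi σ hσ _ ⟨-, -, rfl⟩ n hn
      have := far_add_iff (p := σ.pos) (q := posA h M (t - t)) (v := Dir.vec .S) (n := 0) (n' := n)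
      rw [zero_smul, add_zero] at this
      rw [this]
      cases i with
      | tile a =>
        obtain ⟨h1, h2, rfl⟩ := hσ
        have hat : a ≠ t := fun h => hi (by rw [h])
        simp only [Nat.sub_self, posA, posD, if_true, (show a - t ≠ 0 by omega), if_false, Dir.vec,
          FarXY]
        omega
      | col =>
        obtain ⟨q, hq, rfl⟩ := hσ
        simp only [Nat.sub_self, posA, posD, if_true, Dir.vec, FarXY]
        omega
      | rect =>
        obtain ⟨i, hi, q, hq, rfl⟩ := hσ
        simp only [Nat.sub_self, posA, posD, if_true, Dir.vec, FarXY]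
        omega)
    (by
      intro i j hij hiq hjq σ hσ τ hτ
      rw [← hi i hiq] at hσ
      rw [← hi j hjq] at hτ
      simpa using fam_far hS hcp hrp (fun _ => True) True (fun _ _ _ h => h.elim) (fun _ => hcr) i
        j hij (fun _ _ => trivial) (fun _ => trivial) σ hσ τ hτ 0 (Nat.zero_le _) 0
        (Nat.zero_le _))
    (by
      intro i hiq hne
      rw [← hi i hiq] at hne ⊢
      cases i with
      | tile n => simpa [disp] using tile_halt (mc := 0) (mr := 0) hS n hne
      | col => simpa [disp] using col_halt (m := fun _ => 0) (mr := 0) hcs hne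
      | rect => simpa [disp] using rect_halt (m := fun _ => 0) (mc := 0) hrs hne)
    (by
      rintro _ ⟨-, -, rfl⟩ n h1 h2
      rw [mem_openLocs_track hw hM]
      simp [posA, posD, Dir.vec, IsOpen]
      omega)
    (by
      refine ⟨_, ⟨by omega, ht, rfl⟩, ?_⟩
      rw [mem_region_track]
      simp [posA, posD, Dir.vec]
      omega)
    (by
      rintro _ ⟨-, -, rfl⟩
      rw [mem_blocked_track]
      simp [posA, posD, Dir.vec]
      omega)
  exact ⟨C', hT, hp _ h0 hi⟩

/-- The first tilt that transfers the column into the pit. -/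
theorem tilt_transfer_west {C : Config (track h w M) G} (hh : 0 < h) (hw : 0 < w)
    (hM : 2 * w ≤ M) (hN : N ≤ h * M) (hc : c < w)
    (hC : C.polys = pieces (fam h N lab f (posD h M) t e c h (w + 7) (2 * h + 2) 6)) :
    ∃ C' : Config (track h w M) G, Tilt .W C C' ∧ C'.polys =
      pieces (fam h N lab f (posD h M) t e c h (w + 6) (2 * h + 2) 6) := by
  refine slide_fam (mc := 1) (mr := 0) hw hM hC (slotRun_D_W hw hM (by omega))
    ?_ ?_ ?_ ?_ ?_ ?_ ?_ ?_ ?_ ?_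
  · intro y k _ _ _ _
    refine ⟨isOpen_well ?_ ?_ ?_ ?_, ?_, ?_⟩ <;> simp only [Dir.vec] <;> omega
  · intro _
    refine ⟨h + 3, by omega, by omega, ?_⟩
    simp only [Dir.vec, IsBlocked, IsOpen]; omega
  · intro x y k _ _ _ _ _ _
    refine ⟨isOpen_pit ?_ ?_ ?_ ?_, ?_, ?_⟩ <;> simp only [Dir.vec] <;> omega
  · intro _
    refine ⟨6, 2, by omega, by omega, by omega, by omega, ?_⟩
    simp only [Dir.vec, IsBlocked, IsOpen]; omega
  · intro y x' y' k k' _ _ _ _ _ _ _ _ _ _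
    simp only [Dir.vec, FarXY]; omega
  · exact False.elim
  all_goals simp [Dir.vec] <;> omega

/-- The second tilt that transfers the column into the pit. -/
theorem tilt_transfer_south {C : Config (track h w M) G} (hh : 0 < h) (hw : 0 < w)
    (hM : 2 * w ≤ M) (hN : N ≤ h * M) (hc : c < w)
    (hC : C.polys = pieces (fam h N lab f (posD h M) t e c h (w + 6) (2 * h + 2) 6)) :
    ∃ C' : Config (track h w M) G, Tilt .S C C' ∧ C'.polys =
      pieces (fam h N lab f (posD h M) t e c h (w + 6) (h + 1) 6) := by
  refine slide_fam (mc := h + 1) (mr := 0) hw hM hC (slotRun_D_S hw hM (by omega))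
    ?_ ?_ ?_ ?_ ?_ ?_ ?_ ?_ ?_ ?_
  · intro y k _ _ _ _
    refine ⟨isOpen_shaft ?_ ?_ ?_ ?_, ?_, ?_⟩ <;> simp only [Dir.vec] <;> omega
  · intro _
    refine ⟨h + 3, by omega, by omega, ?_⟩
    simp only [Dir.vec, IsBlocked, IsOpen]; omega
  · intro x y k _ _ _ _ _ _
    refine ⟨isOpen_pit ?_ ?_ ?_ ?_, ?_, ?_⟩ <;> simp only [Dir.vec] <;> omega
  · intro _
    refine ⟨6, 2, by omega, by omega, by omega, by omega, ?_⟩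
    simp only [Dir.vec, IsBlocked, IsOpen]; omega
  · intro y x' y' k k' _ _ _ _ _ _ _ _ _ _
    simp only [Dir.vec, FarXY]; omega
  · exact False.elim
  all_goals simp [Dir.vec] <;> omega

/-- The third tilt that transfers the column into the pit: the rectangle meets the column. -/
theorem tilt_transfer_east {C : Config (track h w M) G} (hG : ∀ a b, G a b = true) (hh : 0 < h)
    (hw : 0 < w) (hM : 2 * w ≤ M) (hN : N ≤ h * M) (hc : c < w)
    (hC : C.polys = pieces (fam h N lab f (posD h M) t e c h (w + 6) (h + 1) 6)) :
    ∃ C' : Config (track h w M) G, Tilt .E C C' ∧ C'.polys =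
      pieces (fam h N lab f (posA h M) t e (c + 1) 0 (w + 7) (h + 2) (w + 7 - c)) := by
  have hS := slotRun_DA (h := h) (w := w) (M := M) (e := e) (K := N - t) hw hM (by omega)
  have hcp : ColPath h w M .E h 1 (w + 6) (h + 1) := by
    intro y k _ _ _ _
    refine ⟨isOpen_pit ?_ ?_ ?_ ?_, ?_, ?_⟩ <;> simp only [Dir.vec] <;> omega
  have hcs : ColStop h w M .E h 1 (w + 6) (h + 1) := by
    intro _
    refine ⟨2, by omega, by omega, ?_⟩
    simp only [Dir.vec, IsBlocked, IsOpen]; omega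
  -- The pit is `w + 2` wide. The column moves on to its last vertical `w + 7`, and the right end of
  -- the rectangle comes to `w + 6`.
  have hrp : RectPath h w M .E c (w + 1 - c) 6 := by
    intro x y k _ _ _ _ _ _
    refine ⟨isOpen_pit ?_ ?_ ?_ ?_, ?_, ?_⟩ <;> simp only [Dir.vec] <;> omega
  have hne : Piece.col ≠ Piece.rect := by simp
  have hres : unite (fam h N lab f (posA h M) t e c h (w + 7) (h + 1) (w + 7 - c)) .rect .col =
      fam h N lab f (posA h M) t e (c + 1) 0 (w + 7) (h + 2) (w + 7 - c) := by
    funext i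
    cases i with
    | tile n => simp [unite, fam]
    | col => simp [unite, fam]
    | rect =>
      ext τ
      simp only [unite, if_true, fam, Set.mem_union, Set.mem_ofPred_eq]
      constructor
      · rintro (⟨i, hi, q, hq, rfl⟩ | ⟨q, hq, rfl⟩)
        · exact ⟨i, by omega, q, hq, rfl⟩
        · exact ⟨c, by omega, q, hq, by simp⟩
      · rintro ⟨i, hi, q, hq, rfl⟩
        rcases Nat.lt_succ_iff_lt_or_eq.1 hi with hi | rfl
        · exact Or.inl ⟨i, hi, q, hq, rfl⟩
        · exact Or.inr ⟨q, hq, by simp⟩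
  have hshift := shift_fam (lab := lab) (f := f) (c := c) (l := h) (mc := 1) (mr := w + 1 - c)
    (cx := w + 6) (ct := h + 1) (rx := 6) (cx' := w + 7) (ct' := h + 1)
    (rx' := w + 7 - c) hS (by simp [Dir.vec]; ring) (by simp [Dir.vec])
    (by simp [Dir.vec]; omega) (by simp [Dir.vec])
  rcases Nat.eq_zero_or_pos c with rfl | h0
  · obtain ⟨C', hT, hp⟩ := slide_fam (mr := w + 1 - 0) (cx' := w + 7) (ct' := h + 1)
      (rx' := w + 7 - (0 : ℕ)) hw hM hC hS hcp hcs hrp (fun h => absurd h (by omega))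
      (fun y x' y' k k' _ _ _ _ _ _ _ _ _ _ => by omega)
      False.elim
      (by simp [Dir.vec]; ring) (by simp [Dir.vec]) (by simp [Dir.vec]; omega) (by simp [Dir.vec])
    refine ⟨C', hT, ?_⟩
    rw [hp, ← hres, pieces_unite_of_empty hne.symm]
    ext τ
    simp [fam]
  · rw [← hres, ← pieces_unite_comm hne, ← hshift]
    -- As `c < w`, contact again comes at time 2 or later, after the single step of the column.
    refine tilt_unite (T := w + 1 - c) (T' := w + 3) hne hC ?_ ?_ ?_ ?_ rfl ?_ ?_ ?_ ?_ ?_ ?_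
    · intro i
      cases i with
      | tile n => simp only [disp]; omega
      | col => simp only [disp]; omega
      | rect => simp only [disp]; omega
    · omega
    · omega
    · simp only [disp]; omega
    · exact ⟨_, 0, h0, 0, hh, rfl⟩
    · exact fun i σ hσ n _ hn => fam_path hw hM hS hcp hrp i σ hσ n hn
    · intro i hi hne
      cases i with
      | tile n => exact tile_halt hS n hne
      | col => exact col_halt hcs hne
      | rect => exact absurd rfl hi
    · intro i j hij h1 h2 σ hσ τ hτ n hn n' hn'
      refine fam_far hS hcp hrp (fun _ => True) False ?_ False.elim i j hij (fun _ _ => trivial) ?_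
        σ hσ τ hτ n hn n' hn'
      · exact fun _ _ _ h => h.elim
      · rintro (⟨rfl, rfl⟩ | ⟨rfl, rfl⟩)
        · exact h1 ⟨rfl, rfl⟩
        · exact h2 ⟨rfl, rfl⟩
    · rintro _ ⟨q', hq', rfl⟩ _ ⟨i, hi, q, hq, rfl⟩ n hn
      rw [far_add_iff]
      simp only [disp, Dir.vec, FarXY]
      omega
    · refine ⟨_, ⟨_, ⟨0, hh, rfl⟩, rfl⟩, _, ⟨_, ⟨c - 1, by omega, 0, hh, rfl⟩, rfl⟩, ?_, hG _ _,
        hG _ _⟩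
      have e1 : (w : ℤ) + 6 + 1 - (6 + ((c - 1 : ℕ) : ℤ) + ((w + 1 - c : ℕ) : ℤ)) = 1 := by omega
      simp [Tile.shift, Adjacent, disp, Dir.vec, e1]

/-- The last tilt that transfers the column into the pit. -/
theorem tilt_transfer_west_last {C : Config (track h w M) G} (hh : 0 < h) (hw : 0 < w)
    (hM : 2 * w ≤ M) (hN : N ≤ h * M) (hc : c ≤ w)
    (hC : C.polys = pieces (fam h N lab f (posA h M) t e c 0 (w + 7) (h + 2) (w + 8 - c))) :
    ∃ C' : Config (track h w M) G, Tilt .W C C' ∧ C'.polys =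
      pieces (fam h N lab f (posD h M) t e c 0 (w + 7) (h + 2) 6) := by
  refine slide_fam (mc := 0) (mr := w + 2 - c) hw hM hC (slotRun_AD hw hM (by omega))
    ?_ ?_ ?_ ?_ ?_ ?_ ?_ ?_ ?_ ?_
  · intro y k _ _ _ _
    omega
  · intro _
    omega
  · intro x y k _ _ _ _ _ _
    refine ⟨isOpen_pit ?_ ?_ ?_ ?_, ?_, ?_⟩ <;> simp only [Dir.vec] <;> omega
  · intro _
    refine ⟨w + 8 - c, 2, by omega, by omega, by omega, by omega, ?_⟩
    simp only [Dir.vec, IsBlocked, IsOpen]; omega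
  · intro y x' y' k k' _ _ _ _ _ _ _ _ _ _
    omega
  · exact False.elim
  all_goals simp [Dir.vec] <;> omega

end Tilts

/-! ### Cycles of tilts and their iteration -/

section Sequences

variable {L : Type} {G : L → L → Bool} {B : Board}

theorem TiltSeq.append {ds ds' : List Dir} {C C' C'' : Config B G} (h : TiltSeq ds C C')
    (h' : TiltSeq ds' C' C'') : TiltSeq (ds ++ ds') C C'' := by
  induction ds generalizing C with
  | nil => cases h; exact h'
  | cons d ds ih =>
    obtain ⟨C₁, h1, h2⟩ := h
    exact ⟨C₁, h1, ih h2⟩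

theorem TiltSeq.reconfigures {ds : List Dir} {C C' : Config B G} (hne : ds ≠ [])
    (h : TiltSeq ds C C') : Reconfigures C C' := by
  induction ds generalizing C with
  | nil => exact absurd rfl hne
  | cons d ds ih =>
    obtain ⟨C₁, h1, h2⟩ := h
    by_cases hd : ds = []
    · subst hd
      cases h2
      exact Relation.TransGen.single ⟨d, h1⟩
    · exact Relation.TransGen.head ⟨d, h1⟩ (ih hd h2)

variable {h w M N t c l k : ℕ} {lab : ℕ → L} {f : ℕ → ℕ → L}

/-- The family of pieces between two cycles of tilts. -/
def restFam (h w M N : ℕ) (lab : ℕ → L) (f : ℕ → ℕ → L) (t l c : ℕ) : Piece → Set (Tile L) :=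
  fam h N lab f (posD h M) t 0 c l (w + 7) (h + 2 + l) 6

/-- A cycle of tilts that adds the front tile to the column. -/
theorem keep_cycle {C : Config (track h w M) G} (hG : ∀ a b, G a b = true) (hh : 0 < h)
    (hw : 0 < w) (hM : 2 * w ≤ M) (hN : N ≤ h * M) (ht : t < N) (hl : l < h) (hc : c ≤ w)
    (hlab : lab t = f c l) (hC : C.polys = pieces (restFam h w M N lab f t l c)) :
    ∃ C' : Config (track h w M) G, TiltSeq [.E, .N, .E, .S, .W, .S] C C' ∧
      C'.polys = pieces (restFam h w M N lab f (t + 1) (l + 1) c) := by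
  obtain ⟨C₁, t₁, h₁⟩ := tilt_east_first hh hw hM hN hl.le hc hC
  obtain ⟨C₂, t₂, h₂⟩ := tilt_north hh hw hM hN hl.le hc h₁
  obtain ⟨C₃, t₃, h₃⟩ := tilt_east_second hh hw hM hN hl.le (fun _ => hl) hc h₂
  obtain ⟨C₄, t₄, h₄⟩ := tilt_south_keep hG hh hw hM hN ht hl hc hlab h₃
  have e : 2 * (h : ℤ) + 3 + l = 2 * h + 2 + ((l + 1 : ℕ) : ℤ) := by push_cast; ring
  rw [e] at h₄
  obtain ⟨C₅, t₅, h₅⟩ := tilt_west hh hw hM hN (show l + 1 ≤ h by omega) hc h₄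
  obtain ⟨C₆, t₆, h₆⟩ := tilt_south_last hh hw hM hN (show l + 1 ≤ h by omega) hc h₅
  exact ⟨C₆, ⟨C₁, t₁, C₂, t₂, C₃, t₃, C₄, t₄, C₅, t₅, C₆, t₆, rfl⟩, h₆⟩

/-- A cycle of tilts that discards the front tile. -/
theorem discard_cycle {C : Config (track h w M) G} (hh : 0 < h)
    (hw : 0 < w) (hM : 2 * w ≤ M) (hN : N ≤ h * M) (ht : t < N) (hl : l ≤ h) (hc : c ≤ w)
    (hC : C.polys = pieces (restFam h w M N lab f t l c)) :
    ∃ C' : Config (track h w M) G, TiltSeq [.E, .S, .N, .E, .S, .W, .S] C C' ∧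
      C'.polys = pieces (restFam h w M N lab f (t + 1) l c) := by
  obtain ⟨C₁, t₁, h₁⟩ := tilt_east_first hh hw hM hN hl hc hC
  obtain ⟨C₀, t₀, h₀⟩ := tilt_discard hh hw hM hN ht hl hc h₁
  obtain ⟨C₂, t₂, h₂⟩ := tilt_north hh hw hM hN hl hc h₀
  obtain ⟨C₃, t₃, h₃⟩ := tilt_east_second hh hw hM hN hl (fun h => absurd h one_ne_zero) hc h₂
  obtain ⟨C₄, t₄, h₄⟩ := tilt_south_first hh hw hM hN hl hc h₃
  obtain ⟨C₅, t₅, h₅⟩ := tilt_west hh hw hM hN hl hc h₄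
  obtain ⟨C₆, t₆, h₆⟩ := tilt_south_last hh hw hM hN hl hc h₅
  exact ⟨C₆, ⟨C₁, t₁, C₀, t₀, C₂, t₂, C₃, t₃, C₄, t₄, C₅, t₅, C₆, t₆, rfl⟩, h₆⟩

/-- A sequence of tilts that adds the completed column to the rectangle. -/
theorem transfer_column {C : Config (track h w M) G} (hG : ∀ a b, G a b = true) (hh : 0 < h)
    (hw : 0 < w) (hM : 2 * w ≤ M) (hN : N ≤ h * M) (hc : c < w)
    (hC : C.polys = pieces (restFam h w M N lab f t h c)) :
    ∃ C' : Config (track h w M) G, TiltSeq [.W, .S, .E, .W] C C' ∧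
      C'.polys = pieces (restFam h w M N lab f t 0 (c + 1)) := by
  have e : (h : ℤ) + 2 + h = 2 * h + 2 := by ring
  have e' : (w : ℤ) + 7 - c = w + 8 - ((c + 1 : ℕ) : ℤ) := by push_cast; ring
  rw [restFam, e] at hC
  obtain ⟨C₁, t₁, h₁⟩ := tilt_transfer_west hh hw hM hN hc hC
  obtain ⟨C₂, t₂, h₂⟩ := tilt_transfer_south hh hw hM hN hc h₁
  obtain ⟨C₃, t₃, h₃⟩ := tilt_transfer_east hG hh hw hM hN hc h₂
  rw [e'] at h₃
  obtain ⟨C₄, t₄, h₄⟩ := tilt_transfer_west_last hh hw hM hN (show c + 1 ≤ w by omega) h₃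
  refine ⟨C₄, ⟨C₁, t₁, C₂, t₂, C₃, t₃, C₄, t₄, rfl⟩, ?_⟩
  rw [h₄, restFam, Nat.cast_zero, add_zero]

variable {g : ℕ → ℕ → Fin (k + 1)} {G' : Fin (k + 1) → Fin (k + 1) → Bool}

/-- The next pixel is added to the column. -/
theorem add_pixel {q : ℕ} {C : Config (track h w M) G'} (hG : ∀ a b, G' a b = true) (hh : 0 < h)
    (hw : 0 < w) (hM : 2 * w ≤ M) (hN : N ≤ h * M) (hk : (k + 1) ∣ t) (ht : t + (k + 1) ≤ N)
    (hq : q < h) (hc : c ≤ w)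
    (hC : C.polys = pieces (restFam h w M N (Fin.ofNat (k + 1)) g t q c)) :
    ∃ (ds : List Dir) (C' : Config (track h w M) G'), ds.length ≤ 7 * (k + 1) ∧ TiltSeq ds C C' ∧
      C'.polys = pieces (restFam h w M N (Fin.ofNat (k + 1)) g (t + (k + 1)) (q + 1) c) := by
  -- Induction through the block of this pixel: the column has grown by one as soon as the wanted
  -- symbol `g c q` has been passed.
  have key : ∀ s ≤ k + 1, ∃ (ds : List Dir) (C' : Config (track h w M) G'),
      ds.length ≤ 7 * s ∧ TiltSeq ds C C' ∧ C'.polys =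
        pieces (restFam h w M N (Fin.ofNat (k + 1)) g (t + s)
          (q + if (g c q : ℕ) < s then 1 else 0) c) := by
    intro s
    induction s with
    | zero => exact fun _ => ⟨[], C, by simp, rfl, by simpa using hC⟩
    | succ s ih =>
      intro hs
      obtain ⟨ds, C₁, h1, h2, h3⟩ := ih (by omega)
      rcases lt_trichotomy (g c q : ℕ) s with hlt | heq | hlt
      · rw [if_pos hlt] at h3
        rw [if_pos (by omega)]
        obtain ⟨C₂, h4, h5⟩ := discard_cycle hh hw hM hN (by omega) (by omega) hc h3
        exact ⟨_, C₂, by simp; omega, h2.append h4, h5⟩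
      · rw [if_neg (by omega)] at h3
        rw [if_pos (by omega)]
        -- Since `k + 1` divides `t`, tile `t + s` is number `s` of its block and carries the symbol
        -- `s`.
        have hlab : Fin.ofNat (k + 1) (t + s) = g c q := by
          apply Fin.ext
          obtain ⟨r, rfl⟩ := hk
          rw [Fin.val_ofNat, Nat.mul_add_mod, ← heq, Nat.mod_eq_of_lt (g c q).isLt]
        obtain ⟨C₂, h4, h5⟩ := keep_cycle hG hh hw hM hN (by omega) (show q + 0 < h by omega) hc
          hlab h3
        exact ⟨_, C₂, by simp; omega, h2.append h4, h5⟩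
      · rw [if_neg (by omega)] at h3
        rw [if_neg (by omega)]
        obtain ⟨C₂, h4, h5⟩ := discard_cycle hh hw hM hN (by omega) (by omega) hc h3
        exact ⟨_, C₂, by simp; omega, h2.append h4, h5⟩
  have := key (k + 1) le_rfl
  rwa [if_pos (g c q).isLt] at this

/-- The next column is added to the rectangle. -/
theorem add_column {C : Config (track h w M) G'} (hG : ∀ a b, G' a b = true) (hh : 0 < h)
    (hw : 0 < w) (hM : 2 * w ≤ M) (hN : N ≤ h * M) (hk : (k + 1) ∣ t)
    (ht : t + h * (k + 1) ≤ N) (hc : c < w)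
    (hC : C.polys = pieces (restFam h w M N (Fin.ofNat (k + 1)) g t 0 c)) :
    ∃ (ds : List Dir) (C' : Config (track h w M) G'), ds.length ≤ 7 * (k + 1) * h + 4 ∧
      ds ≠ [] ∧ TiltSeq ds C C' ∧
      C'.polys = pieces (restFam h w M N (Fin.ofNat (k + 1)) g (t + h * (k + 1)) 0 (c + 1)) := by
  have key : ∀ q ≤ h, ∃ (ds : List Dir) (C' : Config (track h w M) G'),
      ds.length ≤ 7 * (k + 1) * q ∧ TiltSeq ds C C' ∧ C'.polys =
        pieces (restFam h w M N (Fin.ofNat (k + 1)) g (t + q * (k + 1)) q c) := by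
    intro q
    induction q with
    | zero => exact fun _ => ⟨[], C, by simp, rfl, by simpa using hC⟩
    | succ q ih =>
      intro hq
      obtain ⟨ds, C₁, h1, h2, h3⟩ := ih (by omega)
      have hle : (q + 1) * (k + 1) ≤ h * (k + 1) := Nat.mul_le_mul_right _ hq
      have e : (q + 1) * (k + 1) = q * (k + 1) + (k + 1) := by ring
      obtain ⟨ds', C₂, h4, h5, h6⟩ := add_pixel hG hh hw hM hN
        (hk.add (Dvd.intro_left q rfl)) (by omega) (by omega) hc.le h3
      refine ⟨_, C₂, ?_, h2.append h5, ?_⟩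
      · rw [List.length_append, mul_add]; omega
      · rwa [e, ← add_assoc]
  obtain ⟨ds, C₁, h1, h2, h3⟩ := key h le_rfl
  obtain ⟨C₂, h4, h5⟩ := transfer_column hG hh hw hM hN hc h3
  exact ⟨_, C₂, by simp; omega, by simp, h2.append h4, h5⟩

/-- All the columns are put together. -/
theorem build_rect {C : Config (track h w M) G'} (hG : ∀ a b, G' a b = true) (hh : 0 < h)
    (hw : 0 < w) (hM : 2 * w ≤ M) (hN : N ≤ h * M) (hwN : w * (h * (k + 1)) ≤ N)
    (hC : C.polys = pieces (restFam h w M N (Fin.ofNat (k + 1)) g 0 0 0)) :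
    ∃ (ds : List Dir) (C' : Config (track h w M) G'), ds.length ≤ (7 * (k + 1) * h + 4) * w ∧
      ds ≠ [] ∧ TiltSeq ds C C' ∧
      C'.polys = pieces (restFam h w M N (Fin.ofNat (k + 1)) g (w * (h * (k + 1))) 0 w) := by
  have key : ∀ c ≤ w, ∃ (ds : List Dir) (C' : Config (track h w M) G'),
      ds.length ≤ (7 * (k + 1) * h + 4) * c ∧ (0 < c → ds ≠ []) ∧ TiltSeq ds C C' ∧ C'.polys =
        pieces (restFam h w M N (Fin.ofNat (k + 1)) g (c * (h * (k + 1))) 0 c) := by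
    intro c
    induction c with
    | zero => exact fun _ => ⟨[], C, by simp, fun h => absurd h (lt_irrefl 0), rfl, by simpa using hC⟩
    | succ c ih =>
      intro hc
      obtain ⟨ds, C₁, h1, -, h2, h3⟩ := ih (by omega)
      have hle : (c + 1) * (h * (k + 1)) ≤ w * (h * (k + 1)) := Nat.mul_le_mul_right _ hc
      have e : (c + 1) * (h * (k + 1)) = c * (h * (k + 1)) + h * (k + 1) := by ring
      obtain ⟨ds', C₂, h4, hne, h5, h6⟩ := add_column hG hh hw hM hN
        ⟨c * h, by ring⟩ (by omega) (by omega) h3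
      refine ⟨_, C₂, ?_, fun _ => by simp [hne], h2.append h5, ?_⟩
      · rw [List.length_append, mul_add]; omega
      · rwa [e]
  obtain ⟨ds, C', h1, h2, h3⟩ := key w le_rfl
  exact ⟨ds, C', h1, h2 hw, h3⟩

end Sequences

/-! ### The initial and the final configuration, and the constants -/

/-- At the start nothing has been built, so the target pattern does not enter: one configuration
serves all patterns. -/
theorem restFam_start {L : Type} (h w M N : ℕ) (lab : ℕ → L) (f f' : ℕ → ℕ → L) :
    restFam h w M N lab f 0 0 0 = restFam h w M N lab f' 0 0 0 := by
  funext i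
  cases i <;> simp [restFam, fam]

/-- The initial configuration. -/
theorem exists_start {L : Type} {G : L → L → Bool} {h w M N : ℕ} (hw : 0 < w)
    (hM : 2 * w ≤ M) (hN : N ≤ h * M) (lab : ℕ → L) (f : ℕ → ℕ → L) :
    ∃ C : Config (track h w M) G, C.polys = pieces (restFam h w M N lab f 0 0 0) := by
  have hS := slotRun_D_S (h := h) (w := w) (M := M) (e := 0) (K := N - 0) hw hM (by omega)
  have hcp : ColPath h w M .S 0 0 (w + 7) (h + 2 + (0 : ℕ)) := fun y k _ _ _ _ => by omega
  have hrp : RectPath h w M .S 0 0 6 := fun x y k _ _ _ _ _ _ => by omega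
  have hcr : ColRectFar h .S 0 0 0 0 (w + 7) (h + 2 + (0 : ℕ)) 6 :=
    fun y x' y' k k' _ _ _ _ _ _ _ _ _ _ => by omega
  refine exists_config ?_ ?_ ?_ ?_
  · intro i j hij σ hσ τ hτ
    simpa using fam_far hS hcp hrp (fun _ => True) True (fun _ _ _ h => h.elim) (fun _ => hcr) i
      j hij (fun _ _ => trivial) (fun _ => trivial) σ hσ τ hτ 0 (Nat.zero_le _) 0 (Nat.zero_le _)
  · refine ((Set.finite_Iio N).image fun n => {(⟨posD h M n, lab n⟩ : Tile L)}).subset ?_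
    rintro _ ⟨⟨τ, hτ⟩, i, rfl⟩
    cases i with
    | tile n =>
      obtain ⟨-, hn, -⟩ := hτ
      exact ⟨n, hn, by ext τ; simp [restFam, fam, hn]⟩
    | col => simp [restFam, fam] at hτ
    | rect => simp [restFam, fam] at hτ
  · rintro i ⟨τ, hτ⟩
    cases i with
    | tile n =>
      obtain ⟨-, hn, -⟩ := hτ
      have : restFam h w M N lab f 0 0 0 (.tile n) = {(⟨posD h M n, lab n⟩ : Tile L)} := by
        ext τ; simp [restFam, fam, hn]
      rw [this]
      refine ⟨Set.singleton_nonempty _, Set.finite_singleton _, Set.injOn_singleton _ _, ?_⟩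
      rintro _ rfl _ rfl
      exact Relation.ReflTransGen.refl
    | col => simp [restFam, fam] at hτ
    | rect => simp [restFam, fam] at hτ
  · rintro i _ ⟨σ, hσ, rfl⟩
    simpa using fam_path hw hM hS hcp hrp i σ hσ 0 (Nat.zero_le _)

open Classical in
/-- The symbols of a pattern, column by column from the left, each from the top. -/
noncomputable def symbolAt {k : ℕ} (h : ℕ) (u : Pattern (Fin (k + 1))) (i q : ℕ) : Fin (k + 1) :=
  -- The order from the top agrees with the growth of columns at the lower end. The default value
  -- does not reach the finished rectangle.
  if hp : ((i : ℤ) + 1, (h : ℤ) - q) ∈ u.pixels then u.symbol ⟨_, hp⟩ else 0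

/-- The rectangle that has been built represents the pattern. -/
theorem pieces_restFam_end {h w M k : ℕ} (hh : 0 < h) (hw : 0 < w) (lab : ℕ → Fin (k + 1))
    (N : ℕ) {u : Pattern (Fin (k + 1))} (hu : u.pixels = rect w h) :
    pieces (restFam h w M N lab (symbolAt h u) N 0 w) =
      {Set.range fun p : u.pixels => (⟨p.1 + (5, 1), u.symbol p⟩ : Tile (Fin (k + 1)))} := by
  -- The translation by `(5, 1)` takes the lower left pixel `(1, 1)` to the corner `(6, 2)` of the
  -- pit.
  have hrect : restFam h w M N lab (symbolAt h u) N 0 w .rect =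
      Set.range fun p : u.pixels => (⟨p.1 + (5, 1), u.symbol p⟩ : Tile (Fin (k + 1))) := by
    ext τ
    constructor
    · rintro ⟨i, hi, q, hq, rfl⟩
      have hp : ((i : ℤ) + 1, (h : ℤ) - q) ∈ u.pixels := by
        rw [hu]
        simp only [rect, Set.mem_prod, Set.mem_Icc]
        omega
      refine ⟨⟨_, hp⟩, ?_⟩
      simp only [symbolAt, dif_pos hp, Tile.mk.injEq, and_true, Prod.mk_add_mk, Prod.mk.injEq]
      omega
    · rintro ⟨⟨⟨x, y⟩, hp⟩, rfl⟩
      have hp' := hp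
      rw [hu] at hp'
      simp only [rect, Set.mem_prod, Set.mem_Icc] at hp'
      obtain ⟨i, rfl⟩ : ∃ i : ℕ, x = i + 1 := ⟨(x - 1).toNat, by omega⟩
      obtain ⟨q, rfl⟩ : ∃ q : ℕ, y = h - q := ⟨(h - y).toNat, by omega⟩
      refine ⟨i, by omega, q, by omega, ?_⟩
      simp only [symbolAt, dif_pos hp, Tile.mk.injEq, and_true, Prod.mk_add_mk, Prod.mk.injEq]
      omega
  ext P
  constructor
  · rintro ⟨⟨τ, hτ⟩, i, rfl⟩
    cases i with
    | tile n =>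
      obtain ⟨h1, h2, -⟩ := hτ
      omega
    | col => simp [restFam, fam] at hτ
    | rect => exact hrect
  · rintro rfl
    rw [← hrect]
    exact ⟨⟨_, 0, hw, 0, hh, rfl⟩, .rect, rfl⟩

end TiltModel

theorem mainTheorem9 :
    ∃ c : ℕ, ∀ h w k : ℕ, 0 < h → 0 < w → 0 < k →
      ∃ (L : Type) (_ : Finite L) (G : L → L → Bool) (B : TiltModel.Board)
        (C : TiltModel.Config B G) (enc : Fin (k + 1) ↪ L),
        B.size ≤ c * (h * w * k) ∧
        TiltModel.StronglyUniversal enc C (TiltModel.rectPatterns h w (Fin (k + 1))) ∧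
        ∀ u ∈ TiltModel.rectPatterns h w (Fin (k + 1)),
          ∃ (ds : List TiltModel.Dir) (C' : TiltModel.Config B G),
            ds.length ≤ c * (h * w * k) ∧ TiltModel.TiltSeq ds C C' ∧
              TiltModel.StronglyRepresents enc C' u := by
  refine ⟨187, fun h w k hh hw hk => ?_⟩
  -- The track has `M = w * (k + 1)` slots per band, which in `h` bands makes room for all tiles. By
  -- `k ≥ 1` it is also wide enough for the machinery below it.
  have hM : 2 * w ≤ w * (k + 1) := by rw [mul_comm]; exact Nat.mul_le_mul_left _ (by omega)
  have hN : w * (h * (k + 1)) ≤ h * (w * (k + 1)) := le_of_eq (by ring)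
  have h1 : w ≤ w * k := Nat.le_mul_of_pos_right w hk
  have h2 : h ≤ h * k := Nat.le_mul_of_pos_right h hk
  obtain ⟨C, hC⟩ := TiltModel.exists_start (G := fun _ _ => true) hw hM hN (Fin.ofNat (k + 1))
    fun _ _ => 0
  have key : ∀ u ∈ TiltModel.rectPatterns h w (Fin (k + 1)),
      ∃ (ds : List TiltModel.Dir) (C' : TiltModel.Config _ _),
        ds.length ≤ 187 * (h * w * k) ∧ ds ≠ [] ∧ TiltModel.TiltSeq ds C C' ∧
          TiltModel.StronglyRepresents (Function.Embedding.refl (Fin (k + 1))) C' u := by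
    intro u hu
    rw [TiltModel.restFam_start _ _ _ _ _ _ (TiltModel.symbolAt h u)] at hC
    obtain ⟨ds, C', hl, hne, hds, hC'⟩ :=
      TiltModel.build_rect (fun _ _ => rfl) hh hw hM hN le_rfl hC
    refine ⟨ds, C', hl.trans ?_, hne, hds, (5, 1), ?_⟩
    -- Here 18 is 7 + 7 + 4, by `h ≤ h * k` and `1 ≤ h * k`.
    · have h3 : 7 * (k + 1) * h + 4 ≤ 18 * (h * k) := by
        have e : 7 * (k + 1) * h = 7 * (h * k) + 7 * h := by ring
        omega
      calc (7 * (k + 1) * h + 4) * w ≤ 18 * (h * k) * w := Nat.mul_le_mul_right _ h3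
        _ = 18 * (h * w * k) := by ring
        _ ≤ 187 * (h * w * k) := Nat.mul_le_mul_right _ (by norm_num)
    · rw [hC', TiltModel.pieces_restFam_end hh hw _ _ hu]
      rfl
  refine ⟨Fin (k + 1), inferInstance, fun _ _ => true, _, C, Function.Embedding.refl _, ?_,
    -- The set of all configurations that can be reached is universal by definition, so only the
    -- representation of each pattern remains.
    ⟨{C' | TiltModel.Reconfigures C C'}, ?_, fun _ h => h⟩, ?_⟩
  -- The area fixes the constant: 187 is 11 times 17, with 4 + 4 + 3 from the width and 9 + 8 from
  -- the height.
  · have h3 : 4 * (w * (k + 1)) + 3 ≤ 11 * (w * k) := by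
      have e : w * (k + 1) = w * k + w := by ring
      omega
    calc (4 * (w * (k + 1)) + 3) * (9 * h + 8) ≤ 11 * (w * k) * (17 * h) :=
          Nat.mul_le_mul h3 (by omega)
      _ = 187 * (h * w * k) := by ring
  · intro u hu
    obtain ⟨ds, C', -, hne, hds, hC'⟩ := key u hu
    exact ⟨C', hds.reconfigures hne, hC'⟩
  · intro u hu
    obtain ⟨ds, C', hl, -, hds, hC'⟩ := key u hu
    exact ⟨ds, C', hl, hds, hC'⟩
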